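/- Let $LC=LC(\mathbb R^n)$ be the set of all functions $f=e^{-\psi}:\mathbb R^n\to\mathbb R$, with $\psi:\mathbb R^n\to\mathbb R\cup\{\infty\}$ convex, that are upper semicontinuous, integrable and non-degenerate (the support of $f$ has non-empty interior), equipped with the $L_1$-norm. For a nonsingular affine map $B$ of $\mathbb R^n$ put $(Bf)(x)=f(Bx)$. A map $P:LC\to LC$ is called an affine covariant mapping if $\|Pf_m-Pf\|_1\to0$ whenever $f_m,f\in LC$ and $\|f_m-f\|_1\to0$, and if $P(Bf)=B(Pf)$ for every $f\in LC$ and every nonsingular affine map $B$. For $f=e^{-\psi}\in LC$, a Löwner function of $f$ is a function $x\mapsto e^{-\|A_0x\|+t_0}$, where $\|\cdot\|$ is the Euclidean norm and $(A_0,t_0)$ minimizes $$\int_{\mathbb R^n}e^{-\|Ax\|+t}\,dx$$ over all pairs of a nonsingular affine map $A$ of $\mathbb R^n$ and a number $t\in\mathbb R$ such that $\|Ax\|-t\le\psi(x)$ for all $x\in\mathbb R^n$. **Theorem.** Every $f\in LC$ has exactly one Löwner function $L(f)$, it belongs to $LC$, and the Löwner operator $L:LC\to LC$, $f\mapsto L(f)$,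 is an affine covariant mapping. -/

import Mathlib

open MeasureTheory Filter Topology

noncomputable section

/-- The Euclidean space `ℝⁿ` with its Euclidean norm. -/
abbrev Rn (n : ℕ) : Type := EuclideanSpace ℝ (Fin n)

/-- The function `ψ = -log f`, with values in the extended reals and `-log 0 = ∞`;
for `f ≥ 0` it is the unique `ψ` with `f = e^{-ψ}`, see `exp_neg_potential`. -/
def potential {n : ℕ} (f : Rn n → ℝ) (x : Rn n) : EReal :=
  -ENNReal.log (ENNReal.ofReal (f x))

theorem exp_neg_potential {n : ℕ} (f : Rn n → ℝ) (hf : ∀ x, 0 ≤ f x) (x : Rn n) :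
    f x = (EReal.exp (-potential f x)).toReal := by
  rw [potential, neg_neg, ENNReal.exp_log, ENNReal.toReal_ofReal (hf x)]

theorem potential_ne_bot {n : ℕ} (f : Rn n → ℝ) (x : Rn n) : potential f x ≠ ⊥ := by
  rw [potential, Ne, EReal.neg_eq_bot_iff, ENNReal.log_eq_top_iff]
  exact ENNReal.ofReal_ne_top

/-- Log-concavity: `f = e^{-ψ}` with `ψ : ℝⁿ → ℝ ∪ {∞}` convex, that is, with a convex epigraph. -/
def IsLogConcave {n : ℕ} (f : Rn n → ℝ) : Prop :=
  (∀ x, 0 ≤ f x) ∧ Convex ℝ {p : Rn n × ℝ | potential f p.1 ≤ (p.2 : EReal)}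

/-- Membership in the class of upper semicontinuous, integrable, non-degenerate log-concave
functions on `ℝⁿ`. -/
structure MemLC {n : ℕ} (f : Rn n → ℝ) : Prop where
  logConcave : IsLogConcave f
  upperSemicontinuous : UpperSemicontinuous f
  integrable : Integrable f
  nondegenerate : (interior (Function.support f)).Nonempty

/-- The class `LC(ℝⁿ)`. -/
def LC (n : ℕ) : Type := {f : Rn n → ℝ // MemLC f}

/-- The class `LC(ℝⁿ)` is invariant under nonsingular affine changes of variable. -/
theorem MemLC.comp_affineEquiv {n : ℕ} {f : Rn n → ℝ} (hf : MemLC f)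
    (B : Rn n ≃ᵃ[ℝ] Rn n) : MemLC (fun x => f (B x)) := by
  have hB : Continuous B := AffineMap.continuous_of_finiteDimensional (B : Rn n →ᵃ[ℝ] Rn n)
  have hB' : Continuous B.symm :=
    AffineMap.continuous_of_finiteDimensional (B.symm : Rn n →ᵃ[ℝ] Rn n)
  refine ⟨⟨fun x => hf.logConcave.1 _, ?_⟩, ?_, ?_, ?_⟩
  · intro p hp q hq a b ha hb hab
    have h := hf.logConcave.2 (x := (B p.1, p.2)) hp (y := (B q.1, q.2)) hq ha hb hab
    have hc : B (a • p.1 + b • q.1) = a • B p.1 + b • B q.1 :=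
      Convex.combo_affine_apply (f := (B : Rn n →ᵃ[ℝ] Rn n)) hab
    simpa [potential, hc] using h
  · exact hf.upperSemicontinuous.comp hB
  · have hdec : ∀ x, B x = B.linear x + B 0 := fun x => by
      simpa using B.map_vadd 0 x
    have h1 : Integrable (fun x => f (x + B 0)) := hf.integrable.comp_add_right (B 0)
    have hdet : LinearMap.det (B.linear : Rn n →ₗ[ℝ] Rn n) ≠ 0 :=
      (LinearEquiv.isUnit_det' B.linear).ne_zero
    have hmap := Measure.map_linearMap_addHaar_eq_smul_addHaar (volume : Measure (Rn n)) hdet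
    have hlin : Continuous (B.linear : Rn n →ₗ[ℝ] Rn n) :=
      LinearMap.continuous_of_finiteDimensional _
    have h2 : Integrable (fun x => f (x + B 0))
        (Measure.map (B.linear : Rn n →ₗ[ℝ] Rn n) volume) := by
      rw [hmap]
      exact h1.smul_measure ENNReal.ofReal_ne_top
    have h3 := h2.comp_measurable hlin.measurable
    refine h3.congr (Eventually.of_forall fun x => ?_)
    simp [hdec x]
  · obtain ⟨y, hy⟩ := hf.nondegenerate
    refine ⟨B.symm y, mem_interior.2 ⟨B ⁻¹' interior (Function.support f), ?_, ?_, ?_⟩⟩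
    · intro x hx
      exact interior_subset (s := Function.support f) hx
    · exact isOpen_interior.preimage hB
    · simpa using hy

/-- The action `(B f)(x) = f (B x)` of a nonsingular affine map `B` of `ℝⁿ` on `LC(ℝⁿ)`. -/
def LC.act {n : ℕ} (B : Rn n ≃ᵃ[ℝ] Rn n) (f : LC n) : LC n :=
  ⟨fun x => f.1 (B x), f.2.comp_affineEquiv B⟩

/-- Convergence `f_m → f` in the `L₁`-norm. -/
def LC.TendstoL1 {n : ℕ} (f : ℕ → LC n) (g : LC n) : Prop :=
  Tendsto (fun m => ∫ x, |(f m).1 x - g.1 x|) atTop (𝓝 0)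

/-- Affine covariant mappings `P : LC(ℝⁿ) → LC(ℝⁿ)`: continuous for the `L₁`-norm, and
`P (B f) = B (P f)` for all nonsingular affine maps `B`. -/
structure IsAffineCovariant {n : ℕ} (P : LC n → LC n) : Prop where
  continuous_L1 : ∀ (f : ℕ → LC n) (g : LC n),
    LC.TendstoL1 f g → LC.TendstoL1 (fun m => P (f m)) (P g)
  map_act : ∀ (B : Rn n ≃ᵃ[ℝ] Rn n) (f : LC n), P (LC.act B f) = LC.act B (P f)

/-- The function `x ↦ e^{-‖A x‖ + t}`. -/
def coneExp {n : ℕ} (A : Rn n ≃ᵃ[ℝ] Rn n) (t : ℝ) (x : Rn n) : ℝ :=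
  Real.exp (-‖A x‖ + t)

/-- The constraint set: all `(A, t)` with `‖A x‖ - t ≤ ψ x` for all `x`, where `f = e^{-ψ}`. -/
def lownerAdmissible {n : ℕ} (f : Rn n → ℝ) : Set ((Rn n ≃ᵃ[ℝ] Rn n) × ℝ) :=
  {p | ∀ x, ((‖p.1 x‖ - p.2 : ℝ) : EReal) ≤ potential f x}

/-- `(A₀, t₀)` solves the minimization problem: it is admissible and minimizes
`∫ e^{-‖A x‖ + t} dx` among all admissible `(A, t)`. -/
def IsLownerMinimizer {n : ℕ} (f : Rn n → ℝ) (A₀ : Rn n ≃ᵃ[ℝ] Rn n) (t₀ : ℝ) : Prop :=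
  (A₀, t₀) ∈ lownerAdmissible f ∧
    ∀ (A : Rn n ≃ᵃ[ℝ] Rn n) (t : ℝ), (A, t) ∈ lownerAdmissible f →
      ∫ x, coneExp A₀ t₀ x ≤ ∫ x, coneExp A t x

/-- `g` is a Löwner function of `f`: `g x = e^{-‖A₀ x‖ + t₀}` for a minimizer `(A₀, t₀)`. -/
def IsLownerFunction {n : ℕ} (f g : Rn n → ℝ) : Prop :=
  ∃ (A₀ : Rn n ≃ᵃ[ℝ] Rn n) (t₀ : ℝ), IsLownerMinimizer f A₀ t₀ ∧ g = coneExp A₀ t₀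

end

/-! ### Log-concave functions and their potentials -/

/-! Write a candidate as `normExp M b t`. By change of variables its integral is a fixed constant
times `exp (t - log |det M|)`, so the problem is to minimize `t - log |det M|` among the candidates
that dominate `f`.

Existence is compactness. A log-concave `f` in the class decays exponentially
(`MemLC.exists_exp_decay`), so candidates exist. It is at least `exp (-L)` on some ball, which
confines all candidates of bounded value to a compact set (`exists_mem_paramSet`).

Uniqueness is strict concavity of `log det`. After composing one candidate with an isometry, which
changes no norm, the two linear parts differ by a positive diagonal factor; the average of two
minimizers is again admissible, so AM-GM forces that factor to be the identity. The centres then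
agree by a perturbation argument (`IsMinNormExp.translation_eq`).

For continuity, a slightly flattened and lifted majorant of the limit eventually majorizes the
sequence (`eventually_le_normExp`). Hence the limsup of the optimal values is at most the optimal
value of the limit. Limit points of minimizers are then minimizers for the limit, and uniqueness
identifies them. Covariance holds because a substitution `B` multiplies all integrals by one factor.
-/

theorem potential_le_coe_iff {n : ℕ} {f : Rn n → ℝ} {x : Rn n} (a : ℝ) :
    potential f x ≤ (a : EReal) ↔ Real.exp (-a) ≤ f x := by
  rw [potential, EReal.neg_le, ← EReal.coe_neg, ← EReal.log_exp ((-a : ℝ) : EReal),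
    ENNReal.log_le_log_iff, EReal.exp_coe]
  constructor
  · intro h
    by_contra! h'
    exact absurd ((ENNReal.ofReal_lt_ofReal_iff (Real.exp_pos _)).2 h') h.not_gt
  · exact ENNReal.ofReal_le_ofReal

theorem coe_le_potential_iff {n : ℕ} {f : Rn n → ℝ} {x : Rn n} (a : ℝ) :
    (a : EReal) ≤ potential f x ↔ f x ≤ Real.exp (-a) := by
  rw [potential, EReal.le_neg, ← EReal.coe_neg, ← EReal.log_exp ((-a : ℝ) : EReal),
    ENNReal.log_le_log_iff, EReal.exp_coe,
    ENNReal.ofReal_le_ofReal_iff (Real.exp_pos _).le]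

theorem IsLogConcave.exp_le_combo {n : ℕ} {f : Rn n → ℝ} (hf : IsLogConcave f) {x y : Rn n}
    {a b u v : ℝ} (hx : Real.exp (-a) ≤ f x) (hy : Real.exp (-b) ≤ f y) (hu : 0 ≤ u)
    (hv : 0 ≤ v) (huv : u + v = 1) : Real.exp (-(u * a + v * b)) ≤ f (u • x + v • y) := by
  have h := hf.2 (x := (x, a)) ((potential_le_coe_iff a).2 hx) (y := (y, b))
    ((potential_le_coe_iff b).2 hy) hu hv huv
  exact (potential_le_coe_iff (x := u • x + v • y) (u * a + v * b)).1 h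

theorem isLogConcave_of_exp_le_combo {n : ℕ} {f : Rn n → ℝ} (h0 : ∀ x, 0 ≤ f x)
    (h : ∀ (x y : Rn n) (a b u v : ℝ), Real.exp (-a) ≤ f x → Real.exp (-b) ≤ f y → 0 ≤ u →
      0 ≤ v → u + v = 1 → Real.exp (-(u * a + v * b)) ≤ f (u • x + v • y)) :
    IsLogConcave f := by
  refine ⟨h0, fun p hp q hq u v hu hv huv => ?_⟩
  exact (potential_le_coe_iff (x := u • p.1 + v • q.1) (u * p.2 + v * q.2)).2
    (h p.1 q.1 p.2 q.2 u v ((potential_le_coe_iff _).1 hp) ((potential_le_coe_iff _).1 hq) hu hv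
      huv)

theorem IsLogConcave.convex_superlevel {n : ℕ} {f : Rn n → ℝ} (hf : IsLogConcave f) (a : ℝ) :
    Convex ℝ {x | Real.exp (-a) ≤ f x} := by
  intro x hx y hy u v hu hv huv
  have h := hf.exp_le_combo hx hy hu hv huv
  rwa [← add_mul, huv, one_mul] at h

/-! ### Balls contained in convex sets -/

theorem measure_reflect {n : ℕ} (z : Rn n) (s : Set (Rn n)) :
    volume ((fun y => z - y) ⁻¹' s) = volume s :=
  (Measure.measurePreserving_sub_left volume z).measure_preimage_equiv
    (f := MeasurableEquiv.subLeft z) s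

/-- A convex set that misses little of a ball contains the concentric ball of half the radius. -/
theorem Convex.ball_subset_of_measure_diff_lt {n : ℕ} {C : Set (Rn n)} (hC : Convex ℝ C)
    {x : Rn n} {r : ℝ}
    (h : 2 * volume (Metric.ball x r \ C) < volume (Metric.ball (0 : Rn n) (r / 2))) :
    Metric.ball x (r / 2) ⊆ C := by
  intro z hz
  by_contra hzC
  have hsub : Metric.ball z (r / 2) ⊆ Metric.ball x r := by
    refine Metric.ball_subset_ball' ?_
    have := Metric.mem_ball.1 hz
    linarith
  -- If `z ∉ C`, a point `y` and its reflection `2z - y` cannot both lie in `C`, so `C` misses at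
  -- least half of the ball around `z`.
  have hcov : Metric.ball z (r / 2) ⊆ (Metric.ball x r \ C) ∪
      (fun y => (z + z) - y) ⁻¹' (Metric.ball x r \ C) := by
    intro y hy
    by_cases hyC : y ∈ C
    · right
      refine ⟨hsub ?_, fun h' => hzC ?_⟩
      · rw [Metric.mem_ball, dist_eq_norm] at hy ⊢
        rw [← norm_neg]
        have hyz : -(z + z - y - z) = y - z := by abel
        rwa [hyz]
      · have := hC hyC h' (a := 1 / 2) (b := 1 / 2) (by norm_num) (by norm_num) (by norm_num)
        convert this using 1
        module
    · exact Or.inl ⟨hsub hy, hyC⟩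
  have h1 := (measure_mono hcov).trans (measure_union_le (μ := volume) _ _)
  rw [measure_reflect, ← two_mul, Measure.addHaar_ball_center] at h1
  exact absurd h h1.not_gt

theorem volume_ball_pos {n : ℕ} (x : Rn n) {r : ℝ} (hr : 0 < r) :
    0 < volume (Metric.ball x r) := Metric.measure_ball_pos _ _ hr

/-- A member of `LC` is bounded below by a positive constant on some ball. -/
theorem MemLC.exists_ball {n : ℕ} {f : Rn n → ℝ} (hf : MemLC f) :
    ∃ (x : Rn n) (r L : ℝ), 0 < r ∧ ∀ z ∈ Metric.ball x r, Real.exp (-L) ≤ f z := by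
  obtain ⟨x, hx⟩ := hf.nondegenerate
  obtain ⟨r, hr, hsub⟩ := Metric.mem_nhds_iff.1 (mem_interior_iff_mem_nhds.1 hx)
  have hmeas : Measurable f := hf.upperSemicontinuous.measurable
  have hlim : Tendsto (fun k : ℕ => volume (Metric.ball x r \ {y | Real.exp (-(k : ℝ)) ≤ f y}))
      atTop (𝓝 (volume (⋂ k : ℕ, (Metric.ball x r \ {y | Real.exp (-(k : ℝ)) ≤ f y})))) := by
    refine tendsto_measure_iInter_atTop ?_ ?_ ⟨0, ?_⟩
    · intro k
      exact (Metric.isOpen_ball.measurableSet.diff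
        (measurableSet_le measurable_const hmeas)).nullMeasurableSet
    · intro k l hkl y hy
      refine ⟨hy.1, fun h => hy.2 (le_trans (b := Real.exp (-(k : ℝ))) ?_ h)⟩
      exact Real.exp_le_exp.2 (neg_le_neg (by exact_mod_cast hkl))
    · exact ((measure_mono Set.sdiff_subset).trans_lt measure_ball_lt_top).ne
  -- The superlevel sets exhaust the ball, so some level misses little of it and convexity gives the
  -- half ball.
  have hempty : (⋂ k : ℕ, (Metric.ball x r \ {y | Real.exp (-(k : ℝ)) ≤ f y})) = ∅ := by
    refine Set.eq_empty_of_forall_notMem fun y hy => ?_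
    have hy0 := Set.mem_iInter.1 hy
    have hpos : 0 < f y := lt_of_le_of_ne (hf.logConcave.1 y) (Ne.symm (hsub (hy0 0).1))
    obtain ⟨k, hk⟩ := exists_nat_gt (-Real.log (f y))
    refine (hy0 k).2 ?_
    change Real.exp (-(k : ℝ)) ≤ f y
    rw [← Real.le_log_iff_exp_le hpos]
    linarith
  rw [hempty, measure_empty] at hlim
  have hpos := volume_ball_pos (0 : Rn n) (half_pos hr)
  have hlim2 := ENNReal.Tendsto.const_mul (a := 2) hlim (Or.inr (by norm_num))
  rw [mul_zero] at hlim2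
  obtain ⟨k, hk⟩ := (hlim2.eventually (gt_mem_nhds hpos)).exists
  exact ⟨x, r / 2, k, half_pos hr,
    (hf.logConcave.convex_superlevel k).ball_subset_of_measure_diff_lt hk⟩

/-- Interpolation between a point and a ball. -/
theorem IsLogConcave.exp_le_of_mem_ball {n : ℕ} {f : Rn n → ℝ} (hf : IsLogConcave f)
    {x₀ : Rn n} {r L : ℝ} (hL : ∀ z ∈ Metric.ball x₀ r, Real.exp (-L) ≤ f z) {x : Rn n} {a : ℝ}
    (hx : Real.exp (-a) ≤ f x) {s : ℝ} (hs0 : 0 ≤ s) (hs1 : s < 1) {y : Rn n}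
    (hy : y ∈ Metric.ball (s • x + (1 - s) • x₀) ((1 - s) * r)) :
    ∃ z ∈ Metric.ball x₀ r, y = s • x + (1 - s) • z ∧
      Real.exp (-(s * a + (1 - s) * L)) ≤ f y := by
  have h1 : 0 < 1 - s := by linarith
  have hyz : y = s • x + (1 - s) • (x₀ + (1 - s)⁻¹ • (y - (s • x + (1 - s) • x₀))) := by
    rw [smul_add, smul_smul, mul_inv_cancel₀ h1.ne']
    module
  have hz : x₀ + (1 - s)⁻¹ • (y - (s • x + (1 - s) • x₀)) ∈ Metric.ball x₀ r := by
    rw [Metric.mem_ball, dist_eq_norm] at hy ⊢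
    rw [add_sub_cancel_left, norm_smul, Real.norm_of_nonneg (inv_nonneg.2 h1.le),
      inv_mul_lt_iff₀ h1]
    exact hy
  refine ⟨_, hz, hyz, ?_⟩
  rw [hyz]
  exact hf.exp_le_combo hx (hL _ hz) hs0 h1.le (by ring)

/-- A log-concave function dominated almost everywhere by a continuous one is dominated by it. -/
theorem IsLogConcave.le_of_ae_le {n : ℕ} {f g : Rn n → ℝ} (hf : IsLogConcave f)
    {x₀ : Rn n} {r L : ℝ} (hr : 0 < r) (hL : ∀ z ∈ Metric.ball x₀ r, Real.exp (-L) ≤ f z)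
    (hg : Continuous g) (hg0 : ∀ x, 0 < g x) (h : ∀ᵐ x, f x ≤ g x) (x : Rn n) : f x ≤ g x := by
  by_contra! hx
  have hfx : 0 < f x := (hg0 x).trans hx
  set a := -Real.log (f x) with ha
  have hexpa : Real.exp (-a) = f x := by rw [ha, neg_neg, Real.exp_log hfx]
  obtain ⟨c, hc1, hc2⟩ := exists_between hx
  obtain ⟨δ, hδ, hgδ⟩ := Metric.eventually_nhds_iff.1 (hg.continuousAt.eventually (gt_mem_nhds hc1))
  -- Moving from `x` by a small fraction `l` towards the ball reaches a whole small ball on which `f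
  -- > c > g`; this contradicts the almost everywhere bound.
  have hcont1 : Tendsto (fun l : ℝ => Real.exp (-((1 - l) * a + (1 - (1 - l)) * L))) (𝓝[>] 0)
      (𝓝 (f x)) := by
    have : Continuous (fun l : ℝ => Real.exp (-((1 - l) * a + (1 - (1 - l)) * L))) := by fun_prop
    have h' := this.tendsto 0
    simp only [sub_zero, sub_self, one_mul, zero_mul, add_zero, hexpa] at h'
    exact h'.mono_left nhdsWithin_le_nhds
  have hcont2 : Tendsto (fun l : ℝ => l * (‖x₀ - x‖ + r)) (𝓝[>] 0) (𝓝 0) := by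
    have : Continuous (fun l : ℝ => l * (‖x₀ - x‖ + r)) := by fun_prop
    have h' := this.tendsto 0
    simp only [zero_mul] at h'
    exact h'.mono_left nhdsWithin_le_nhds
  have hev : ∀ᶠ l : ℝ in 𝓝[>] 0, l < 1 :=
    (eventually_lt_nhds (zero_lt_one)).filter_mono nhdsWithin_le_nhds
  obtain ⟨l, hl1, hl2, hl3, hl0⟩ := ((hcont1.eventually (lt_mem_nhds hc2)).and
    ((hcont2.eventually (gt_mem_nhds hδ)).and (hev.and self_mem_nhdsWithin))).exists
  have hl0' : 0 < l := hl0
  have hpos := volume_ball_pos ((1 - l) • x + (1 - (1 - l)) • x₀)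
    (r := (1 - (1 - l)) * r) (by nlinarith)
  have hnull : volume (Metric.ball ((1 - l) • x + (1 - (1 - l)) • x₀) ((1 - (1 - l)) * r)) = 0 := by
    refine measure_mono_null ?_ (ae_iff.1 h)
    intro y hy
    obtain ⟨z, hz, hyz, hfy⟩ := hf.exp_le_of_mem_ball hL hexpa.le (by linarith) (by linarith) hy
    have hgy : g y < c := by
      refine hgδ (lt_of_le_of_lt ?_ hl2)
      have : y - x = l • ((x₀ - x) + (z - x₀)) := by rw [hyz]; module
      rw [dist_eq_norm, this, norm_smul, Real.norm_of_nonneg hl0'.le]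
      refine mul_le_mul_of_nonneg_left ((norm_add_le _ _).trans ?_) hl0'.le
      have := Metric.mem_ball.1 hz
      rw [dist_eq_norm] at this
      linarith
    exact not_le.2 (hgy.trans (hl1.trans_le hfy))
  exact hpos.ne' hnull

/-! ### Exponential decay -/

/-- A large value at one point forces mass on the ball halfway to `x₀`. With `S` the whole space
this bounds `f`; with `S` a tail it makes `f` small far away. -/
theorem MemLC.exp_mul_volume_le {n : ℕ} {f : Rn n → ℝ} (hf : MemLC f) {x₀ : Rn n} {r L : ℝ}
    (hL : ∀ z ∈ Metric.ball x₀ r, Real.exp (-L) ≤ f z) {x : Rn n} {a : ℝ}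
    (hx : Real.exp (-a) ≤ f x) {S : Set (Rn n)}
    (hsub : Metric.ball ((1 / 2 : ℝ) • x + (1 - 1 / 2 : ℝ) • x₀) ((1 - 1 / 2) * r) ⊆ S) :
    Real.exp (-(1 / 2 * a + (1 - 1 / 2) * L)) * volume.real (Metric.ball (0 : Rn n) ((1 - 1 / 2) * r))
      ≤ ∫ y in S, f y := by
  set B := Metric.ball ((1 / 2 : ℝ) • x + (1 - 1 / 2 : ℝ) • x₀) ((1 - 1 / 2) * r) with hB
  have h1 : ∫ _ in B, Real.exp (-(1 / 2 * a + (1 - 1 / 2) * L)) ≤ ∫ y in B, f y := by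
    refine setIntegral_mono_on ?_ hf.integrable.integrableOn Metric.isOpen_ball.measurableSet ?_
    · exact integrableOn_const measure_ball_lt_top.ne
    · intro y hy
      obtain ⟨z, -, -, h⟩ := hf.logConcave.exp_le_of_mem_ball hL hx (by norm_num) (by norm_num) hy
      exact h
  have h2 : ∫ y in B, f y ≤ ∫ y in S, f y :=
    setIntegral_mono_set hf.integrable.integrableOn
      (Eventually.of_forall fun y => hf.logConcave.1 y) (LE.le.eventuallyLE hsub)
  rw [setIntegral_const, smul_eq_mul, mul_comm, hB, measureReal_def,
    Measure.addHaar_ball_center, ← measureReal_def] at h1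
  exact h1.trans h2

theorem MemLC.exists_setIntegral_tail_lt {n : ℕ} {f : Rn n → ℝ} (hf : MemLC f) {ε : ℝ}
    (hε : 0 < ε) : ∃ k : ℕ, ∫ y in {y : Rn n | (k : ℝ) ≤ ‖y‖}, f y < ε := by
  have hlim := tendsto_setIntegral_of_antitone (μ := volume) (f := f)
    (s := fun k : ℕ => {y : Rn n | (k : ℝ) ≤ ‖y‖})
    (fun k => measurableSet_le measurable_const measurable_norm)
    (fun k l hkl y hy => le_trans (b := (l : ℝ)) (by exact_mod_cast hkl) hy)
    ⟨0, hf.integrable.integrableOn⟩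
  have hempty : (⋂ k : ℕ, {y : Rn n | (k : ℝ) ≤ ‖y‖}) = ∅ := by
    refine Set.eq_empty_of_forall_notMem fun y hy => ?_
    obtain ⟨k, hk⟩ := exists_nat_gt ‖y‖
    exact absurd (Set.mem_iInter.1 hy k) (not_le.2 hk)
  rw [hempty, setIntegral_empty] at hlim
  exact (hlim.eventually (gt_mem_nhds hε)).exists

theorem MemLC.exists_exp_decay {n : ℕ} {f : Rn n → ℝ} (hf : MemLC f) :
    ∃ α C : ℝ, 0 < α ∧ ∀ x, f x ≤ Real.exp (-(α * ‖x‖) + C) := by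
  obtain ⟨x₀, r, L, hr, hL⟩ := hf.exists_ball
  set c := volume.real (Metric.ball (0 : Rn n) ((1 - 1 / 2) * r)) with hc
  have hcpos : 0 < c := by
    rw [hc, measureReal_def]
    exact ENNReal.toReal_pos (volume_ball_pos _ (by linarith)).ne' measure_ball_lt_top.ne
  set I := ∫ y, f y with hI
  have hbound : ∀ x a, Real.exp (-a) ≤ f x → Real.exp (-(1 / 2 * a + (1 - 1 / 2) * L)) * c ≤ I := by
    intro x a hx
    have := hf.exp_mul_volume_le hL hx (Set.subset_univ _)
    rwa [setIntegral_univ] at this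
  have hIpos : 0 < I := lt_of_lt_of_le (by positivity)
    (hbound x₀ L (hL x₀ (Metric.mem_ball_self hr)))
  obtain ⟨k, hk⟩ := hf.exists_setIntegral_tail_lt
    (ε := Real.exp (-(1 / 2 * (L + 1) + (1 - 1 / 2) * L)) * c) (by positivity)
  have hfar : ∀ x, 2 * k + r + ‖x₀‖ ≤ ‖x‖ → f x < Real.exp (-(L + 1)) := by
    intro x hx
    by_contra! h
    refine absurd (hf.exp_mul_volume_le hL h ?_) hk.not_ge
    intro y hy
    rw [Metric.mem_ball, dist_eq_norm] at hy
    change (k : ℝ) ≤ ‖y‖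
    have e : (1 / 2 : ℝ) • x = y - (y - ((1 / 2 : ℝ) • x + (1 - 1 / 2 : ℝ) • x₀))
        - (1 - 1 / 2 : ℝ) • x₀ := by module
    have h1 := (norm_sub_le (y - (y - ((1 / 2 : ℝ) • x + (1 - 1 / 2 : ℝ) • x₀)))
      ((1 - 1 / 2 : ℝ) • x₀))
    have h2 := norm_sub_le y (y - ((1 / 2 : ℝ) • x + (1 - 1 / 2 : ℝ) • x₀))
    rw [← e, norm_smul, norm_smul] at h1
    norm_num at h1 h2 hy
    linarith
  set R := 2 * k + r + 2 * ‖x₀‖ with hR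
  have hRpos : 0 < R := by positivity
  -- The potential is at most `L` at `x₀` and exceeds `L + 1` at distance `R`, so convexity makes it
  -- grow with slope at least `1 / R` beyond.
  have hout : ∀ x, R ≤ ‖x - x₀‖ → f x ≤ Real.exp (-(L + ‖x - x₀‖ / R)) := by
    intro x hx
    by_contra! h
    set ρ := ‖x - x₀‖ with hρ
    have hρpos : 0 < ρ := hRpos.trans_le hx
    have hs1 : R / ρ ≤ 1 := (div_le_one hρpos).2 hx
    have h1 := hf.logConcave.exp_le_combo h.le (hL x₀ (Metric.mem_ball_self hr))
      (u := R / ρ) (v := 1 - R / ρ) (by positivity) (by linarith) (by ring)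
    have h2 : R / ρ * (L + ρ / R) + (1 - R / ρ) * L = L + 1 := by field_simp; ring
    rw [h2] at h1
    refine absurd h1 (hfar _ ?_).not_ge
    have e : (R / ρ) • (x - x₀) = ((R / ρ) • x + (1 - R / ρ) • x₀) - x₀ := by module
    have h3 := norm_sub_le ((R / ρ) • x + (1 - R / ρ) • x₀) x₀
    rw [← e, norm_smul, Real.norm_of_nonneg (by positivity), ← hρ, div_mul_cancel₀ _ hρpos.ne'] at h3
    linarith
  -- Solves `exp (-(a + L) / 2) * c = I` for `a`.
  set A := 2 * (-Real.log (I / c)) - L with hA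
  have hin : ∀ x, f x ≤ Real.exp (-A) := by
    intro x
    by_contra! h
    obtain ⟨q, hq1, hq2⟩ := exists_between h
    have hqpos : 0 < q := (Real.exp_pos _).trans hq1
    have h1 := hbound x (-Real.log q) (by rw [neg_neg, Real.exp_log hqpos]; exact hq2.le)
    rw [← le_div_iff₀ hcpos, ← Real.le_log_iff_exp_le (by positivity)] at h1
    have h2 := (Real.lt_log_iff_exp_lt hqpos).2 hq1
    linarith
  refine ⟨R⁻¹, ‖x₀‖ / R + 1 + |L| + |A|, inv_pos.2 hRpos, fun x => ?_⟩
  have hq : 0 ≤ ‖x₀‖ / R := by positivity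
  have htri : ‖x‖ ≤ ‖x - x₀‖ + ‖x₀‖ := by simpa using norm_add_le (x - x₀) x₀
  have hdiv : R⁻¹ * ‖x‖ ≤ ‖x - x₀‖ / R + ‖x₀‖ / R := by
    rw [← add_div, inv_mul_eq_div]
    exact div_le_div_of_nonneg_right htri hRpos.le
  have := neg_abs_le L
  have := neg_abs_le A
  have := abs_nonneg A
  have := abs_nonneg L
  rcases le_total R ‖x - x₀‖ with h | h
  · refine (hout x h).trans (Real.exp_le_exp.2 ?_)
    linarith
  · refine (hin x).trans (Real.exp_le_exp.2 ?_)
    have := (div_le_one hRpos).2 h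
    linarith

/-! ### Exponentials of negative Euclidean norms -/

/-- The function `x ↦ e^{-‖M x + b‖ + t}`. -/
noncomputable def normExp {n : ℕ} (M : Rn n →L[ℝ] Rn n) (b : Rn n) (t : ℝ) (x : Rn n) : ℝ :=
  Real.exp (-‖M x + b‖ + t)

theorem normExp_pos {n : ℕ} (M : Rn n →L[ℝ] Rn n) (b : Rn n) (t : ℝ) (x : Rn n) :
    0 < normExp M b t x := Real.exp_pos _

theorem continuous_normExp {n : ℕ} (M : Rn n →L[ℝ] Rn n) (b : Rn n) (t : ℝ) :
    Continuous (normExp M b t) := by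
  unfold normExp
  fun_prop

theorem integrable_exp_neg_norm (n : ℕ) : Integrable (fun x : Rn n => Real.exp (-‖x‖)) := by
  have h := (integrable_one_add_norm (E := Rn n) (μ := volume) (r := ((n + 1 : ℕ) : ℝ))
    (by simp)).const_mul (Real.exp 1 * (n + 1).factorial)
  refine h.mono' (by fun_prop) (Eventually.of_forall fun x => ?_)
  have hx : 0 < 1 + ‖x‖ := by positivity
  have h1 := Real.pow_div_factorial_le_exp (1 + ‖x‖) hx.le (n + 1)
  rw [Real.norm_of_nonneg (Real.exp_pos _).le, Real.rpow_neg hx.le, Real.rpow_natCast,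
    ← div_eq_mul_inv, le_div_iff₀ (by positivity), Real.exp_neg, inv_mul_le_iff₀ (Real.exp_pos _)]
  rw [div_le_iff₀ (by positivity), Real.exp_add] at h1
  linarith

theorem map_continuousLinearMap_volume {n : ℕ} {M : Rn n →L[ℝ] Rn n} (hM : M.det ≠ 0) :
    Measure.map M volume = ENNReal.ofReal |M.det|⁻¹ • (volume : Measure (Rn n)) := by
  have := Measure.map_linearMap_addHaar_eq_smul_addHaar (volume : Measure (Rn n))
    (f := (M : Rn n →ₗ[ℝ] Rn n)) hM
  rw [abs_inv] at this
  exact this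

theorem integrable_normExp {n : ℕ} {M : Rn n →L[ℝ] Rn n} (hM : M.det ≠ 0) (b : Rn n) (t : ℝ) :
    Integrable (normExp M b t) := by
  have h1 : Integrable (fun x : Rn n => Real.exp (-‖x + b‖ + t)) := by
    simp only [Real.exp_add]
    exact ((integrable_exp_neg_norm n).comp_add_right b).mul_const _
  have h2 : Integrable (fun x : Rn n => Real.exp (-‖x + b‖ + t)) (Measure.map M volume) := by
    rw [map_continuousLinearMap_volume hM]
    exact h1.smul_measure ENNReal.ofReal_ne_top
  exact h2.comp_measurable M.measurable

theorem integral_normExp {n : ℕ} {M : Rn n →L[ℝ] Rn n} (hM : M.det ≠ 0) (b : Rn n) (t : ℝ) :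
    ∫ x, normExp M b t x = Real.exp (t - Real.log |M.det|) * ∫ x : Rn n, Real.exp (-‖x‖) := by
  have h1 : ∫ x, normExp M b t x = ∫ x, Real.exp (-‖x + b‖ + t) ∂(Measure.map M volume) := by
    rw [integral_map M.measurable.aemeasurable (by fun_prop)]
    rfl
  rw [h1, map_continuousLinearMap_volume hM, integral_smul_measure]
  simp only [Real.exp_add]
  rw [integral_mul_const, integral_add_right_eq_self (fun x : Rn n => Real.exp (-‖x‖)) b,
    ENNReal.toReal_ofReal (by positivity), Real.exp_sub, Real.exp_log (abs_pos.2 hM), smul_eq_mul]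
  ring

theorem integral_exp_neg_norm_pos (n : ℕ) : 0 < ∫ x : Rn n, Real.exp (-‖x‖) :=
  integral_exp_pos (integrable_exp_neg_norm n)

theorem memLC_normExp {n : ℕ} {M : Rn n →L[ℝ] Rn n} (hM : M.det ≠ 0) (b : Rn n) (t : ℝ) :
    MemLC (normExp M b t) := by
  refine ⟨isLogConcave_of_exp_le_combo (fun x => (normExp_pos M b t x).le) ?_,
    (continuous_normExp M b t).upperSemicontinuous, integrable_normExp hM b t, ?_⟩
  · intro x y p q u v hp hq hu hv huv
    have hp' := Real.exp_le_exp.1 hp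
    have hq' := Real.exp_le_exp.1 hq
    refine Real.exp_le_exp.2 ?_
    have e : M (u • x + v • y) + b = u • (M x + b) + v • (M y + b) := by
      rw [map_add, map_smul, map_smul, smul_add, smul_add, add_add_add_comm, ← add_smul, huv,
        one_smul]
    have h := norm_add_le (u • (M x + b)) (v • (M y + b))
    rw [← e, norm_smul, norm_smul, Real.norm_of_nonneg hu, Real.norm_of_nonneg hv] at h
    have ht : t = u * t + v * t := by rw [← add_mul, huv, one_mul]
    nlinarith
  · have : Function.support (normExp M b t) = Set.univ :=
      Set.eq_univ_of_forall fun x => (normExp_pos M b t x).ne'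
    rw [this, interior_univ]
    exact Set.univ_nonempty

/-! ### Compactness and existence of minimizers -/

/-- The image of the unit ball lies in the ball of radius `‖M‖`; compare volumes. -/
theorem ContinuousLinearMap.abs_det_le_norm_pow {n : ℕ} (M : Rn n →L[ℝ] Rn n) :
    |M.det| ≤ ‖M‖ ^ n := by
  have h1 := Measure.addHaar_image_continuousLinearMap (volume : Measure (Rn n)) M
    (Metric.ball 0 1)
  have h2 : M '' Metric.ball 0 1 ⊆ Metric.closedBall 0 ‖M‖ := by
    rintro _ ⟨x, hx, rfl⟩
    rw [mem_closedBall_zero_iff]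
    rw [mem_ball_zero_iff] at hx
    exact (M.le_opNorm x).trans (mul_le_of_le_one_right (norm_nonneg _) hx.le)
  have h3 := measure_mono (μ := (volume : Measure (Rn n))) h2
  rw [h1, Measure.addHaar_closedBall _ _ (norm_nonneg _), finrank_euclideanSpace_fin,
    ENNReal.mul_le_mul_iff_left (volume_ball_pos _ one_pos).ne' measure_ball_lt_top.ne,
    ENNReal.ofReal_le_ofReal_iff (by positivity)] at h3
  exact h3

/-- `(M, b, t)` minimizes `t - log |det M|`, hence the integral of `e^{-‖M x + b‖ + t}`, among
the functions of this form that dominate `f`. -/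
structure IsMinNormExp {n : ℕ} (f : Rn n → ℝ) (M : Rn n →L[ℝ] Rn n) (b : Rn n) (t : ℝ) :
    Prop where
  det_ne_zero : M.det ≠ 0
  le : ∀ x, f x ≤ normExp M b t x
  minimal : ∀ (M' : Rn n →L[ℝ] Rn n) (b' : Rn n) (t' : ℝ), M'.det ≠ 0 →
    (∀ x, f x ≤ normExp M' b' t' x) → t - Real.log |M.det| ≤ t' - Real.log |M'.det|

/-- The bounded set of parameters with determinant bounded away from zero. -/
def paramSet (n : ℕ) (R δ : ℝ) : Set ((Rn n →L[ℝ] Rn n) × Rn n × ℝ) :=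
  Metric.closedBall 0 R ∩ {p | δ ≤ |p.1.det|}

theorem continuous_abs_det (n : ℕ) :
    Continuous fun p : (Rn n →L[ℝ] Rn n) × Rn n × ℝ => |p.1.det| :=
  (ContinuousLinearMap.continuous_det.comp continuous_fst).abs

theorem isCompact_paramSet (n : ℕ) (R δ : ℝ) : IsCompact (paramSet n R δ) :=
  (isCompact_closedBall 0 R).inter_right
    (isClosed_le continuous_const (continuous_abs_det n))

theorem mem_paramSet {n : ℕ} {R δ : ℝ} {M : Rn n →L[ℝ] Rn n} {b : Rn n} {t : ℝ} :
    (M, b, t) ∈ paramSet n R δ ↔ (‖M‖ ≤ R ∧ ‖b‖ ≤ R ∧ |t| ≤ R) ∧ δ ≤ |M.det| := by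
  simp [paramSet, Prod.norm_def]

theorem continuous_normExp_param {n : ℕ} (x : Rn n) :
    Continuous fun p : (Rn n →L[ℝ] Rn n) × Rn n × ℝ => normExp p.1 p.2.1 p.2.2 x := by
  unfold normExp
  fun_prop

theorem continuousOn_sub_log_det (n : ℕ) {R δ : ℝ} (hδ : 0 < δ) :
    ContinuousOn (fun p : (Rn n →L[ℝ] Rn n) × Rn n × ℝ => p.2.2 - Real.log |p.1.det|)
      (paramSet n R δ) := by
  refine ContinuousOn.sub (by fun_prop) ?_
  exact (continuous_abs_det n).continuousOn.log fun p hp => (hδ.trans_le hp.2).ne'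

/-- The bounds depend only on the ball, `L` and `v`, not on `f`, so they serve a whole sequence at
once. On the ball `‖M z + b‖ ≤ t + L`, hence `‖M‖ ≤ 4 (t + L) / r` and `|det M|` is at most
polynomial in `t + L`; bounded value makes it at least `exp (t - v)`. So `t` is bounded above, and
`t ≥ -L` bounds the determinant below. -/
theorem exists_mem_paramSet {n : ℕ} (x₀ : Rn n) {r : ℝ} (L v : ℝ) (hr : 0 < r) :
    ∃ R δ : ℝ, 0 < δ ∧ ∀ (f : Rn n → ℝ) (M : Rn n →L[ℝ] Rn n) (b : Rn n) (t : ℝ),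
      (∀ z ∈ Metric.ball x₀ r, Real.exp (-L) ≤ f z) → M.det ≠ 0 →
      (∀ x, f x ≤ normExp M b t x) → t - Real.log |M.det| ≤ v → (M, b, t) ∈ paramSet n R δ := by
  obtain ⟨T, hT⟩ := eventually_atTop.1 ((Real.tendsto_exp_div_pow_atTop n).eventually
    (eventually_gt_atTop (Real.exp (L + v) * (4 / r) ^ n)))
  set S := max T 1 with hS
  have hS1 : 1 ≤ S := le_max_right _ _
  refine ⟨S + |L| + 4 * S / r + 4 * S / r * ‖x₀‖, Real.exp (-L - v), Real.exp_pos _, ?_⟩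
  intro f M b t hL hM hle hv
  have hball : ∀ z ∈ Metric.ball x₀ r, ‖M z + b‖ ≤ t + L := by
    intro z hz
    have := Real.exp_le_exp.1 ((hL z hz).trans (hle z))
    linarith
  have h0 := hball x₀ (Metric.mem_ball_self hr)
  have hτ : 0 ≤ t + L := (norm_nonneg _).trans h0
  have hMnorm : ‖M‖ ≤ 4 * (t + L) / r := by
    refine M.opNorm_le_bound (by positivity) fun x => ?_
    rcases eq_or_ne x 0 with rfl | hx
    · simp
    have hxn : 0 < ‖x‖ := norm_pos_iff.2 hx
    have hmem : x₀ + (r / (2 * ‖x‖)) • x ∈ Metric.ball x₀ r := by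
      rw [Metric.mem_ball, dist_eq_norm, add_sub_cancel_left, norm_smul,
        Real.norm_of_nonneg (by positivity)]
      field_simp
      norm_num
    have h1 := norm_sub_le (M (x₀ + (r / (2 * ‖x‖)) • x) + b) (M x₀ + b)
    have e : M (x₀ + (r / (2 * ‖x‖)) • x) + b - (M x₀ + b) = (r / (2 * ‖x‖)) • M x := by
      rw [map_add, map_smul]; abel
    rw [e, norm_smul, Real.norm_of_nonneg (by positivity)] at h1
    have h2 : r / (2 * ‖x‖) * ‖M x‖ ≤ 2 * (t + L) := by linarith [hball _ hmem]
    rw [div_mul_eq_mul_div, div_le_iff₀ (by positivity)] at h2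
    rw [div_mul_eq_mul_div, le_div_iff₀ hr]
    linarith
  have hdetpos : 0 < |M.det| := abs_pos.2 hM
  have hdet : Real.exp (t - v) ≤ |M.det| := by
    rw [← Real.le_log_iff_exp_le hdetpos]
    linarith
  have hτS : t + L ≤ S := by
    by_contra! h
    have hpos : 0 < t + L := by linarith
    have h1 := hT (t + L) ((le_max_left _ _).trans h.le)
    rw [lt_div_iff₀ (by positivity)] at h1
    have h2 : Real.exp (t - v) ≤ (4 * (t + L) / r) ^ n :=
      (hdet.trans M.abs_det_le_norm_pow).trans (pow_le_pow_left₀ (norm_nonneg _) hMnorm n)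
    have h3 : Real.exp (t + L) = Real.exp (L + v) * Real.exp (t - v) := by
      rw [← Real.exp_add]; ring_nf
    have h4 : (4 * (t + L) / r) ^ n = (4 / r) ^ n * (t + L) ^ n := by
      rw [← mul_pow]; ring_nf
    rw [h4] at h2
    rw [h3, mul_assoc] at h1
    exact absurd h2 (lt_of_mul_lt_mul_left h1 (Real.exp_pos _).le).not_ge
  have hMS : ‖M‖ ≤ 4 * S / r := hMnorm.trans (by gcongr)
  have hq : 0 ≤ 4 * S / r := by positivity
  have hq2 : 0 ≤ 4 * S / r * ‖x₀‖ := by positivity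
  refine mem_paramSet.2 ⟨⟨?_, ?_, ?_⟩, ?_⟩
  · linarith [abs_nonneg L]
  · have h1 : ‖b‖ ≤ ‖M x₀ + b‖ + ‖M x₀‖ := by simpa using norm_sub_le (M x₀ + b) (M x₀)
    have h2 := M.le_of_opNorm_le hMS x₀
    linarith [abs_nonneg L]
  · rw [abs_le]
    constructor <;> linarith [neg_abs_le L, le_abs_self L]
  · refine le_trans (Real.exp_le_exp.2 ?_) hdet
    linarith

theorem MemLC.exists_normExp_ge {n : ℕ} {f : Rn n → ℝ} (hf : MemLC f) :
    ∃ (M : Rn n →L[ℝ] Rn n) (b : Rn n) (t : ℝ), M.det ≠ 0 ∧ ∀ x, f x ≤ normExp M b t x := by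
  obtain ⟨α, C, hα, h⟩ := hf.exists_exp_decay
  refine ⟨α • ContinuousLinearMap.id ℝ (Rn n), 0, C, ?_, fun x => ?_⟩
  · rw [ContinuousLinearMap.det, ContinuousLinearMap.toLinearMap_smul, LinearMap.det_smul,
      ContinuousLinearMap.coe_id, LinearMap.det_id, mul_one]
    positivity
  · refine (h x).trans_eq ?_
    simp [normExp, norm_smul, abs_of_pos hα]

theorem MemLC.exists_isMinNormExp {n : ℕ} {f : Rn n → ℝ} (hf : MemLC f) :
    ∃ (M : Rn n →L[ℝ] Rn n) (b : Rn n) (t : ℝ), IsMinNormExp f M b t := by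
  obtain ⟨x₀, r, L, hr, hL⟩ := hf.exists_ball
  obtain ⟨M₁, b₁, t₁, hM₁, h₁⟩ := hf.exists_normExp_ge
  obtain ⟨R, δ, hδ, hK⟩ := exists_mem_paramSet x₀ L (t₁ - Real.log |M₁.det|) hr
  have hclosed : IsClosed {p : (Rn n →L[ℝ] Rn n) × Rn n × ℝ |
      ∀ x, f x ≤ normExp p.1 p.2.1 p.2.2 x} := by
    rw [Set.ofPred_forall]
    exact isClosed_iInter fun x => isClosed_le continuous_const (continuous_normExp_param x)
  obtain ⟨⟨M, b, t⟩, hp, hmin⟩ := ((isCompact_paramSet n R δ).inter_right hclosed).exists_isMinOn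
    ⟨(M₁, b₁, t₁), hK f M₁ b₁ t₁ hL hM₁ h₁ le_rfl, h₁⟩
    ((continuousOn_sub_log_det n hδ).mono Set.inter_subset_left)
  refine ⟨M, b, t, abs_pos.1 (hδ.trans_le hp.1.2), hp.2, fun M' b' t' hM' h' => ?_⟩
  by_cases hv : t' - Real.log |M'.det| ≤ t₁ - Real.log |M₁.det|
  · exact hmin (show (M', b', t') ∈ _ from ⟨hK f M' b' t' hL hM' h' hv, h'⟩)
  · exact (hmin (show (M₁, b₁, t₁) ∈ _ from ⟨hK f M₁ b₁ t₁ hL hM₁ h₁ le_rfl, h₁⟩)).trans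
      (not_le.1 hv).le

/-! ### Uniqueness of minimizers -/

/-- Polar decomposition: a nonsingular operator is, up to an isometry on the left, diagonal with
positive entries in some orthonormal basis. -/
theorem ContinuousLinearMap.exists_isometry_comp_diagonal {n : ℕ} {K : Rn n →L[ℝ] Rn n}
    (hK : Function.Injective K) :
    ∃ (U : Rn n ≃ₗᵢ[ℝ] Rn n) (e : OrthonormalBasis (Fin n) ℝ (Rn n)) (c : Fin n → ℝ),
      (∀ i, 0 < c i) ∧ ∀ i, U (K (e i)) = c i • e i := by
  have hT := (ContinuousLinearMap.isPositive_adjoint_comp_self K).isSelfAdjoint.isSymmetric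
  set e := hT.eigenvectorBasis (finrank_euclideanSpace_fin (𝕜 := ℝ) (n := n)) with he
  have hne : ∀ i, K (e i) ≠ 0 := fun i h =>
    e.toBasis.ne_zero i (by simpa using hK (h.trans (map_zero K).symm))
  have horth : ∀ i j, i ≠ j → inner ℝ (K (e i)) (K (e j)) = 0 := by
    intro i j hij
    have h1 := hT.apply_eigenvectorBasis (finrank_euclideanSpace_fin (𝕜 := ℝ) (n := n)) i
    rw [← ContinuousLinearMap.adjoint_inner_left]
    have h2 : (K.adjoint) (K (e i)) =
        (hT.eigenvalues (finrank_euclideanSpace_fin (𝕜 := ℝ) (n := n)) i) • e i := h1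
    rw [h2, inner_smul_left, e.orthonormal.2 hij, mul_zero]
  have hv : Orthonormal ℝ fun i => ‖K (e i)‖⁻¹ • K (e i) := by
    refine ⟨fun i => ?_, fun i j hij => ?_⟩
    · rw [norm_smul, norm_inv, norm_norm, inv_mul_cancel₀ (norm_ne_zero_iff.2 (hne i))]
    · change inner ℝ (‖K (e i)‖⁻¹ • K (e i)) (‖K (e j)‖⁻¹ • K (e j)) = 0
      rw [inner_smul_left, inner_smul_right, horth i j hij, mul_zero, mul_zero]
  obtain ⟨b, hb⟩ := Orthonormal.exists_orthonormalBasis_extension_of_card_eq (𝕜 := ℝ)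
    (ι := Fin n) (E := Rn n) (by simp) (v := fun i => ‖K (e i)‖⁻¹ • K (e i)) (s := Set.univ)
    (hv.comp _ Subtype.val_injective)
  refine ⟨b.equiv e (Equiv.refl _), e, fun i => ‖K (e i)‖, fun i => norm_pos_iff.2 (hne i),
    fun i => ?_⟩
  have h1 : K (e i) = ‖K (e i)‖ • b i := by
    rw [hb i (Set.mem_univ i), smul_smul, mul_inv_cancel₀ (norm_ne_zero_iff.2 (hne i)), one_smul]
  conv_lhs => rw [h1]
  rw [map_smul, OrthonormalBasis.equiv_apply_basis]
  rfl

theorem ContinuousLinearMap.det_eq_prod_of_diagonal {n : ℕ} {P : Rn n →L[ℝ] Rn n}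
    (e : OrthonormalBasis (Fin n) ℝ (Rn n)) {c : Fin n → ℝ} (h : ∀ i, P (e i) = c i • e i) :
    P.det = ∏ i, c i := by
  rw [ContinuousLinearMap.det, ← LinearMap.det_toMatrix e.toBasis, ← Matrix.det_diagonal]
  congr 1
  ext i j
  rw [LinearMap.toMatrix_apply, ContinuousLinearMap.coe_coe, e.coe_toBasis, h, map_smul,
    Finsupp.smul_apply, ← e.coe_toBasis, Module.Basis.repr_self, Matrix.diagonal_apply,
    Finsupp.single_apply]
  rcases eq_or_ne i j with rfl | hij
  · simp
  · simp [hij, hij.symm]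

theorem ContinuousLinearMap.det_comp {n : ℕ} (A B : Rn n →L[ℝ] Rn n) :
    (A.comp B).det = A.det * B.det :=
  LinearMap.det_comp _ _

theorem ContinuousLinearMap.det_smul {n : ℕ} (c : ℝ) (A : Rn n →L[ℝ] Rn n) :
    (c • A).det = c ^ n * A.det := by
  rw [ContinuousLinearMap.det, ContinuousLinearMap.toLinearMap_smul, LinearMap.det_smul,
    finrank_euclideanSpace_fin]

theorem sub_log_det_eq_of_normExp_eq {n : ℕ} {M M' : Rn n →L[ℝ] Rn n} {b b' : Rn n} {t t' : ℝ}
    (hM : M.det ≠ 0) (hM' : M'.det ≠ 0) (h : normExp M b t = normExp M' b' t') :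
    t - Real.log |M.det| = t' - Real.log |M'.det| := by
  have h1 := integral_normExp hM b t
  rw [h, integral_normExp hM' b' t'] at h1
  exact (Real.exp_injective (mul_right_cancel₀ (integral_exp_neg_norm_pos n).ne' h1)).symm

/-- AM-GM for `1` and `c`; the equality case follows. Together they give strict concavity of `log
det` on diagonal matrices. -/
theorem half_log_le_log_half {c : ℝ} (hc : 0 < c) :
    Real.log c / 2 ≤ Real.log ((1 / 2) * (1 + c)) := by
  rw [div_le_iff₀ two_pos, mul_comm, ← Nat.cast_two, ← Real.log_pow]
  exact Real.log_le_log hc (by nlinarith [sq_nonneg (1 - c)])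

theorem eq_one_of_half_log_eq {c : ℝ} (hc : 0 < c)
    (h : Real.log c / 2 = Real.log ((1 / 2) * (1 + c))) : c = 1 := by
  rw [div_eq_iff two_ne_zero, mul_comm, ← Nat.cast_two, ← Real.log_pow] at h
  have h2 := Real.log_injOn_pos hc (Set.mem_Ioi.2 (by positivity)) h
  nlinarith [sq_nonneg (1 - c)]

/-- Plain averaging gains nothing here, since the determinants agree. Instead the averaged candidate
is scaled by `1 - w ^ 2`, which costs order `w ^ 2`, while `t` drops by `w * ‖d‖`, of order `w`. -/
theorem IsMinNormExp.translation_eq {n : ℕ} {f : Rn n → ℝ} {M : Rn n →L[ℝ] Rn n} {b₁ b₂ : Rn n}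
    {t : ℝ} (h₁ : IsMinNormExp f M b₁ t) (h₂ : IsMinNormExp f M b₂ t) : b₁ = b₂ := by
  set d := (1 / 2 : ℝ) • (b₁ - b₂) with hd
  by_contra hne
  have hdpos : 0 < ‖d‖ := by
    rw [hd, norm_smul]
    exact mul_pos (by norm_num) (norm_pos_iff.2 (sub_ne_zero.2 hne))
  -- The cost is at most `2 * n * w ^ 2`; the factor `2 * n + 1` makes the gain strictly larger.
  obtain ⟨w, hw0, hw1, hw2⟩ : ∃ w : ℝ, 0 < w ∧ w ≤ 1 / 2 ∧ (2 * n + 1) * w ≤ ‖d‖ := by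
    refine ⟨min (1 / 2) (‖d‖ / (2 * n + 1)), by positivity, min_le_left _ _, ?_⟩
    rw [mul_comm, ← le_div_iff₀ (by positivity)]
    exact min_le_right _ _
  have hσ : 0 < 1 - w ^ 2 := by nlinarith
  have hdet : ((1 - w ^ 2) • M).det = (1 - w ^ 2) ^ n * M.det := ContinuousLinearMap.det_smul _ _
  have hmin := h₁.minimal ((1 - w ^ 2) • M) ((1 - w ^ 2) • ((1 / 2 : ℝ) • (b₁ + b₂)))
    (t - w * ‖d‖) (by rw [hdet]; exact mul_ne_zero (by positivity) h₁.det_ne_zero) ?_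
  · rw [hdet, abs_mul, abs_of_pos (pow_pos hσ n), Real.log_mul (pow_pos hσ n).ne'
      (abs_pos.2 h₁.det_ne_zero).ne', Real.log_pow] at hmin
    have h3 := Real.one_sub_inv_le_log_of_pos hσ
    have h4 : (1 - w ^ 2)⁻¹ ≤ 1 + 2 * w ^ 2 := by
      rw [inv_le_iff_one_le_mul₀ hσ]
      have h8 : 0 ≤ 1 - 2 * w ^ 2 := by nlinarith
      nlinarith [mul_nonneg (sq_nonneg w) h8]
    have h5 : (n : ℝ) * (-(2 * w ^ 2)) ≤ n * Real.log (1 - w ^ 2) :=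
      mul_le_mul_of_nonneg_left (by linarith) (Nat.cast_nonneg n)
    have h6 : w * ‖d‖ ≤ w * (2 * n * w) := by nlinarith
    have h7 := le_of_mul_le_mul_left h6 hw0
    linarith
  · intro x
    set y := M x + (1 / 2 : ℝ) • (b₁ + b₂) with hy
    have e : ((1 - w ^ 2) • M) x + (1 - w ^ 2) • ((1 / 2 : ℝ) • (b₁ + b₂)) = (1 - w ^ 2) • y := by
      rw [hy, smul_add (1 - w ^ 2)]; rfl
    have hpar := parallelogram_law_with_norm ℝ y d
    have e1 : y + d = M x + b₁ := by rw [hy, hd]; module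
    have e2 : y - d = M x + b₂ := by rw [hy, hd]; module
    -- By the parallelogram law the larger of `‖y ± d‖ ^ 2` is at least `‖y‖ ^ 2 + ‖d‖ ^ 2`;
    -- Cauchy-Schwarz with `(1 - w ^ 2) ^ 2 + w ^ 2 ≤ 1` does the rest.
    have hkey : (1 - w ^ 2) * ‖y‖ + w * ‖d‖ ≤ ‖y + d‖ ∨
        (1 - w ^ 2) * ‖y‖ + w * ‖d‖ ≤ ‖y - d‖ := by
      by_contra! hcon
      have q1 := mul_self_lt_mul_self (norm_nonneg _) hcon.1
      have q2 := mul_self_lt_mul_self (norm_nonneg _) hcon.2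
      have q3 : ((1 - w ^ 2) * ‖y‖ + w * ‖d‖) * ((1 - w ^ 2) * ‖y‖ + w * ‖d‖) ≤
          ‖y‖ * ‖y‖ + ‖d‖ * ‖d‖ := by
        have q4 : 0 ≤ w ^ 2 * (1 - w ^ 2) * (‖y‖ * ‖y‖ + ‖d‖ * ‖d‖) := by positivity
        nlinarith [sq_nonneg (w * ‖y‖ - (1 - w ^ 2) * ‖d‖)]
      linarith
    rw [e1, e2] at hkey
    rw [normExp, e, norm_smul, Real.norm_of_nonneg hσ.le]
    rcases hkey with h | h
    · exact (h₁.le x).trans (Real.exp_le_exp.2 (by linarith))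
    · exact (h₂.le x).trans (Real.exp_le_exp.2 (by linarith))

theorem IsMinNormExp.of_normExp_eq {n : ℕ} {f : Rn n → ℝ} {M M' : Rn n →L[ℝ] Rn n} {b b' : Rn n}
    {t t' : ℝ} (h : IsMinNormExp f M b t) (hM' : M'.det ≠ 0)
    (heq : normExp M' b' t' = normExp M b t) : IsMinNormExp f M' b' t' := by
  refine ⟨hM', fun x => (h.le x).trans_eq (congrFun heq x).symm, fun A c s hA hle => ?_⟩
  rw [sub_log_det_eq_of_normExp_eq hM' h.det_ne_zero heq]
  exact h.minimal A c s hA hle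

theorem IsMinNormExp.normExp_eq {n : ℕ} {f : Rn n → ℝ} {M₁ M₂ : Rn n →L[ℝ] Rn n} {b₁ b₂ : Rn n}
    {t₁ t₂ : ℝ} (h₁ : IsMinNormExp f M₁ b₁ t₁) (h₂ : IsMinNormExp f M₂ b₂ t₂) :
    normExp M₁ b₁ t₁ = normExp M₂ b₂ t₂ := by
  set A := LinearMap.equivOfDetNeZero (M₁ : Rn n →ₗ[ℝ] Rn n) h₁.det_ne_zero with hA
  have hAx : ∀ x, A x = M₁ x := fun x => rfl
  set N : Rn n →L[ℝ] Rn n := LinearMap.toContinuousLinearMap (A.symm : Rn n →ₗ[ℝ] Rn n) with hN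
  have hNM : ∀ x, N (M₁ x) = x := fun x => A.symm_apply_apply x
  have hM₂inj : Function.Injective M₂ :=
    (LinearMap.equivOfDetNeZero (M₂ : Rn n →ₗ[ℝ] Rn n) h₂.det_ne_zero).injective
  obtain ⟨U, e, c, hc, hUe⟩ := (M₂.comp N).exists_isometry_comp_diagonal
    (hM₂inj.comp A.symm.injective)
  set P : Rn n →L[ℝ] Rn n := (U : Rn n →L[ℝ] Rn n).comp (M₂.comp N) with hP
  have hPe : ∀ i, P (e i) = c i • e i := hUe
  have hPM : ∀ x, P (M₁ x) = U (M₂ x) := fun x => by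
    change U (M₂ (N (M₁ x))) = _
    rw [hNM]
  have hlog : ∀ i, 0 < (1 / 2) * (1 + c i) := fun i => by have := hc i; positivity
  have hPdet : P.det = ∏ i, c i := P.det_eq_prod_of_diagonal e hPe
  have hPpos : 0 < P.det := by rw [hPdet]; exact Finset.prod_pos fun i _ => hc i
  -- The isometry `U` leaves the function unchanged, so the second minimizer may be taken with
  -- linear part `P ∘ M₁`.
  have heq : normExp (P.comp M₁) (U b₂) t₂ = normExp M₂ b₂ t₂ := by
    funext x
    rw [normExp, normExp, ContinuousLinearMap.comp_apply, hPM, ← map_add, U.norm_map]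
  have h₂' : IsMinNormExp f (P.comp M₁) (U b₂) t₂ := h₂.of_normExp_eq
    (by rw [ContinuousLinearMap.det_comp]; exact mul_ne_zero hPpos.ne' h₁.det_ne_zero) heq
  have hd₁ : 0 < |M₁.det| := abs_pos.2 h₁.det_ne_zero
  have hval : t₁ = t₂ - Real.log P.det := by
    have q1 := h₁.minimal _ _ _ h₂'.det_ne_zero h₂'.le
    have q2 := h₂'.minimal _ _ _ h₁.det_ne_zero h₁.le
    rw [ContinuousLinearMap.det_comp, abs_mul, abs_of_pos hPpos,
      Real.log_mul hPpos.ne' hd₁.ne'] at q1 q2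
    linarith
  set Q : Rn n →L[ℝ] Rn n := (1 / 2 : ℝ) • (ContinuousLinearMap.id ℝ (Rn n) + P) with hQ
  have hQe : ∀ i, Q (e i) = ((1 / 2) * (1 + c i)) • e i := fun i => by
    change (1 / 2 : ℝ) • (e i + P (e i)) = _
    rw [hPe, mul_smul, add_smul, one_smul]
  have hQdet : Q.det = ∏ i, (1 / 2) * (1 + c i) := Q.det_eq_prod_of_diagonal e hQe
  have hQpos : 0 < Q.det := by rw [hQdet]; exact Finset.prod_pos fun i _ => hlog i
  -- By convexity of the norm the averaged candidate is at least the geometric mean of the two,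
  -- hence at least `f`. Its minimality inequality reads `log det Q ≤ (log det P) / 2`, the reverse
  -- of AM-GM.
  have hmid := h₁.minimal (Q.comp M₁) ((1 / 2 : ℝ) • (b₁ + U b₂)) ((t₁ + t₂) / 2)
    (by rw [ContinuousLinearMap.det_comp]; exact mul_ne_zero hQpos.ne' h₁.det_ne_zero) (by
      intro x
      have q1 := h₁.le x
      have q2 := h₂'.le x
      have q3 : Q.comp M₁ x + (1 / 2 : ℝ) • (b₁ + U b₂) =
          (1 / 2 : ℝ) • ((M₁ x + b₁) + (P.comp M₁ x + U b₂)) := by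
        change (1 / 2 : ℝ) • (M₁ x + P (M₁ x)) + (1 / 2 : ℝ) • (b₁ + U b₂) =
          (1 / 2 : ℝ) • ((M₁ x + b₁) + (P (M₁ x) + U b₂))
        module
      have q4 := norm_add_le (M₁ x + b₁) (P.comp M₁ x + U b₂)
      rw [normExp, q3, norm_smul, Real.norm_of_nonneg (by norm_num)]
      rcases le_total (-‖M₁ x + b₁‖ + t₁) (-‖P.comp M₁ x + U b₂‖ + t₂) with h | h
      · exact q1.trans (Real.exp_le_exp.2 (by linarith))
      · exact q2.trans (Real.exp_le_exp.2 (by linarith)))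
  rw [ContinuousLinearMap.det_comp, abs_mul, abs_of_pos hQpos,
    Real.log_mul hQpos.ne' hd₁.ne'] at hmid
  have hsum : ∑ i, Real.log ((1 / 2) * (1 + c i)) ≤ ∑ i, Real.log (c i) / 2 := by
    rw [← Real.log_prod fun i _ => (hlog i).ne', ← Finset.sum_div,
      ← Real.log_prod fun i _ => (hc i).ne', ← hQdet, ← hPdet]
    linarith
  have hle : ∀ i ∈ Finset.univ, Real.log (c i) / 2 ≤ Real.log ((1 / 2) * (1 + c i)) :=
    fun i _ => half_log_le_log_half (hc i)
  have hone : ∀ i, c i = 1 := fun i => eq_one_of_half_log_eq (hc i)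
    ((Finset.sum_eq_sum_iff_of_le hle).1 (le_antisymm (Finset.sum_le_sum hle) hsum) i
      (Finset.mem_univ i))
  have hPid : P = ContinuousLinearMap.id ℝ (Rn n) := by
    refine ContinuousLinearMap.coe_injective (e.toBasis.ext fun i => ?_)
    rw [e.coe_toBasis]
    change P (e i) = e i
    rw [hPe, hone, one_smul]
  have ht : t₁ = t₂ := by
    rw [hval, hPdet]
    simp [hone]
  rw [hPid, ContinuousLinearMap.id_comp, ← ht] at h₂' heq
  rw [← ht, ← heq, h₁.translation_eq h₂']

/-! ### Stability under convergence in the mean -/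

theorem tendstoInMeasure_of_tendsto_integral_abs_sub {n : ℕ} {f : ℕ → Rn n → ℝ} {g : Rn n → ℝ}
    (hf : ∀ m, MemLC (f m)) (hg : MemLC g)
    (h : Tendsto (fun m => ∫ x, |f m x - g x|) atTop (𝓝 0)) :
    TendstoInMeasure volume f atTop g := by
  refine tendstoInMeasure_of_tendsto_eLpNorm one_ne_zero
    (fun m => (hf m).integrable.aestronglyMeasurable) hg.integrable.aestronglyMeasurable ?_
  have h1 : ∀ m, eLpNorm (f m - g) 1 volume = ENNReal.ofReal (∫ x, |f m x - g x|) := by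
    intro m
    rw [eLpNorm_one_eq_lintegral_enorm]
    exact (ofReal_integral_norm_eq_lintegral_enorm ((hf m).integrable.sub hg.integrable)).symm
  simp only [h1]
  have h2 := (ENNReal.continuous_ofReal.tendsto 0).comp h
  rwa [ENNReal.ofReal_zero] at h2

/-- Convergence in measure makes a convex superlevel set of `f m` miss little of a ball where `g` is
large, so one ball and one bound serve all late `m`. -/
theorem exists_ball_eventually {n : ℕ} {f : ℕ → Rn n → ℝ} {g : Rn n → ℝ}
    (hf : ∀ m, MemLC (f m)) (hg : MemLC g) (h : TendstoInMeasure volume f atTop g) :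
    ∃ (x : Rn n) (r L : ℝ), 0 < r ∧ (∀ z ∈ Metric.ball x r, Real.exp (-L) ≤ g z) ∧
      ∀ᶠ m in atTop, ∀ z ∈ Metric.ball x r, Real.exp (-L) ≤ f m z := by
  obtain ⟨x, r, L, hr, hL⟩ := hg.exists_ball
  have hlt : Real.exp (-(L + 1)) < Real.exp (-L) := Real.exp_lt_exp.2 (by linarith)
  refine ⟨x, r / 2, L + 1, half_pos hr, fun z hz =>
    hlt.le.trans (hL z (Metric.ball_subset_ball (by linarith) hz)), ?_⟩
  have h1 := ENNReal.Tendsto.const_mul (a := 2)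
    (tendstoInMeasure_iff_norm.1 h _ (sub_pos.2 hlt)) (Or.inr (by norm_num))
  rw [mul_zero] at h1
  filter_upwards [h1.eventually (gt_mem_nhds (volume_ball_pos (0 : Rn n) (half_pos hr)))] with m hm
  refine ((hf m).logConcave.convex_superlevel (L + 1)).ball_subset_of_measure_diff_lt
    (lt_of_le_of_lt ?_ hm)
  gcongr
  rintro z ⟨hz, hzC⟩
  have h2 : f m z < Real.exp (-(L + 1)) := not_le.1 hzC
  change _ ≤ ‖f m z - g z‖
  rw [Real.norm_eq_abs, abs_sub_comm]
  exact le_trans (by linarith [hL z hz]) (le_abs_self _)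

theorem ContinuousLinearMap.exists_mul_norm_le {n : ℕ} {M : Rn n →L[ℝ] Rn n} (hM : M.det ≠ 0) :
    ∃ κ : ℝ, 0 < κ ∧ ∀ x, κ * ‖x‖ ≤ ‖M x‖ := by
  set A := M.toContinuousLinearEquivOfDetNeZero hM with hA
  refine ⟨(‖(A.symm : Rn n →L[ℝ] Rn n)‖ + 1)⁻¹, by positivity, fun x => ?_⟩
  rw [inv_mul_le_iff₀ (by positivity)]
  have h1 := (A.symm : Rn n →L[ℝ] Rn n).le_opNorm (M x)
  have h2 : (A.symm : Rn n →L[ℝ] Rn n) (M x) = x := A.symm_apply_apply x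
  rw [h2] at h1
  nlinarith [norm_nonneg (M x)]

/-- The arithmetic of `eventually_le_normExp`, with `X = ‖M x + b‖` and `Y = ‖M y + b‖`. The gap
between the two majorants at `y` has logarithm `(1 - σ) * Y + ε`; moving from `x` to `y` costs at
most `(1 - s) * K`, and half the gap survives. -/
theorem neg_add_half_gap_le {s σ X Y t ε L B K : ℝ} (hs : 0 ≤ 1 - s) (hσ0 : 0 ≤ σ) (hσ1 : σ ≤ 1)
    (hB : 0 ≤ B) (hK : t + ε + L + B ≤ K) (hX : s * X ≤ Y + (1 - s) * B)
    (hgap : (1 - s) * K ≤ ((1 - σ) * Y + ε) / 2) :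
    -(Y - t) + ((1 - σ) * Y + ε) / 2 ≤ -(s * (σ * X - t - ε) + (1 - s) * L) := by
  have h1 := mul_le_mul_of_nonneg_left hX hσ0
  have h2 : σ * ((1 - s) * B) ≤ (1 - s) * B := mul_le_of_le_one_left (mul_nonneg hs hB) hσ1
  have h3 := mul_le_mul_of_nonneg_left hK hs
  linarith

/-- A slightly flattened and lifted majorant of the limit eventually dominates the sequence. -/
theorem eventually_le_normExp {n : ℕ} {f : ℕ → Rn n → ℝ} {g : Rn n → ℝ}
    (hf : ∀ m, MemLC (f m)) (h : TendstoInMeasure volume f atTop g) {x₀ : Rn n} {r L : ℝ}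
    (hr : 0 < r) (hL : ∀ᶠ m in atTop, ∀ z ∈ Metric.ball x₀ r, Real.exp (-L) ≤ f m z)
    {M : Rn n →L[ℝ] Rn n} (hM : M.det ≠ 0) {b : Rn n} {t : ℝ} (hle : ∀ x, g x ≤ normExp M b t x)
    {σ ε : ℝ} (hσ0 : 0 < σ) (hσ1 : σ < 1) (hε : 0 < ε) :
    ∀ᶠ m in atTop, ∀ x, f m x ≤ normExp (σ • M) (σ • b) (t + ε) x := by
  obtain ⟨κ, hκ, hκM⟩ := ContinuousLinearMap.exists_mul_norm_le hM
  set B := ‖M‖ * (‖x₀‖ + r) + ‖b‖ with hB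
  have hB0 : 0 ≤ B := by positivity
  set K := B + |t| + ε + |L| with hK
  have hKε : ε ≤ K := by linarith [abs_nonneg t, abs_nonneg L]
  have hKpos : 0 < K := hε.trans_le hKε
  -- Moving by the fraction `l` costs `l * K = ε / 2`, at most half the gap.
  set l := ε / (2 * K) with hl
  have hl0 : 0 < l := by positivity
  have hl1 : l ≤ 1 / 2 := by rw [hl, div_le_iff₀ (by positivity)]; linarith
  have hlK : l * K = ε / 2 := by rw [hl]; field_simp
  have hσ' : 0 < 1 - σ := by linarith
  -- Beyond distance `R - r` from `x₀`, `(1 - σ) * ‖M y + b‖ ≥ 2 * K`, so half the gap covers even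
  -- the full cost `K`.
  set R := r + (2 * K / (1 - σ) + B) / κ with hR
  have hRpos : 0 < R := by positivity
  have hRκ : κ * (R - r) = 2 * K / (1 - σ) + B := by rw [hR]; field_simp; ring
  set H := ‖M‖ * (R + r) + B + |t| with hH
  have hsmall := (tendstoInMeasure_iff_norm.1 h (Real.exp (-H) * (ε / 2)) (by positivity)).eventually
    (gt_mem_nhds (volume_ball_pos (0 : Rn n) (mul_pos hl0 hr)))
  filter_upwards [hsmall, hL] with m hm hLm x
  -- A violation at `x`, however distant, makes `f m - g` at least `exp (-H) * (ε / 2)` on a ball of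
  -- radius `l * r`, against convergence in measure.
  by_contra! hx
  have hNz : ∀ z ∈ Metric.ball x₀ r, ‖M z + b‖ ≤ B := by
    intro z hz
    rw [Metric.mem_ball, dist_eq_norm] at hz
    have h1 : ‖z‖ ≤ ‖x₀‖ + r := by
      have := norm_add_le x₀ (z - x₀)
      rw [add_sub_cancel] at this
      linarith
    refine (norm_add_le _ _).trans (add_le_add (M.le_of_opNorm_le_of_le le_rfl h1) le_rfl)
  have hx' : Real.exp (-(σ * ‖M x + b‖ - t - ε)) ≤ f m x := by
    refine le_trans (le_of_eq ?_) hx.le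
    have e : (σ • M) x + σ • b = σ • (M x + b) := by rw [smul_add]; rfl
    rw [normExp, e, norm_smul, Real.norm_of_nonneg hσ0.le]
    congr 1
    ring
  -- Stay near `x` if `x` is not far; otherwise pull back to distance `R`, so that `H` bounds the
  -- exponent uniformly in `x`.
  obtain ⟨s, hs0, hs1, hsR, hsor⟩ : ∃ s : ℝ, 0 ≤ s ∧ s ≤ 1 - l ∧ s * ‖x - x₀‖ ≤ R ∧
      (s = 1 - l ∨ s * ‖x - x₀‖ = R) := by
    rcases le_or_gt ((1 - l) * ‖x - x₀‖) R with hc | hc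
    · exact ⟨1 - l, by linarith, le_rfl, hc, Or.inl rfl⟩
    · have hpos : 0 < ‖x - x₀‖ := by
        by_contra! h0
        have := le_antisymm h0 (norm_nonneg _)
        rw [this, mul_zero] at hc
        linarith
      have e : R / ‖x - x₀‖ * ‖x - x₀‖ = R := div_mul_cancel₀ _ hpos.ne'
      refine ⟨R / ‖x - x₀‖, by positivity, ?_, e.le, Or.inr e⟩
      rw [div_le_iff₀ hpos]
      exact hc.le
  refine absurd hm (not_lt.2 ?_)
  rw [← Measure.addHaar_ball_center volume (s • x + (1 - s) • x₀)]
  refine measure_mono fun y hy => ?_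
  have hy' : y ∈ Metric.ball (s • x + (1 - s) • x₀) ((1 - s) * r) :=
    Metric.ball_subset_ball (by nlinarith) hy
  obtain ⟨z, hz, hyz, hfy⟩ := (hf m).logConcave.exp_le_of_mem_ball hLm hx' hs0 (by linarith) hy'
  have h1s : 0 ≤ 1 - s := by linarith
  have hzr : ‖z - x₀‖ ≤ r := by
    rw [Metric.mem_ball, dist_eq_norm] at hz
    exact hz.le
  have hyx : y - x₀ = s • (x - x₀) + (1 - s) • (z - x₀) := by rw [hyz]; module
  have hzr' : ‖(1 - s) • (z - x₀)‖ ≤ r := by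
    rw [norm_smul, Real.norm_of_nonneg h1s]
    nlinarith [norm_nonneg (z - x₀)]
  have hsx : ‖s • (x - x₀)‖ = s * ‖x - x₀‖ := by rw [norm_smul, Real.norm_of_nonneg hs0]
  have hx₀ := hNz x₀ (Metric.mem_ball_self hr)
  have hMy : M y + b = M (y - x₀) + (M x₀ + b) := by rw [map_sub]; abel
  have hyub : ‖M y + b‖ ≤ ‖M‖ * (R + r) + B := by
    rw [hMy]
    refine (norm_add_le _ _).trans (add_le_add (M.le_of_opNorm_le_of_le le_rfl ?_) hx₀)
    rw [hyx]
    exact (norm_add_le _ _).trans (add_le_add (hsx.le.trans hsR) hzr')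
  have hconv : s * ‖M x + b‖ ≤ ‖M y + b‖ + (1 - s) * B := by
    have e : s • (M x + b) = (M y + b) - (1 - s) • (M z + b) := by
      rw [hyz, map_add, map_smul, map_smul]; module
    have h2 := norm_sub_le (M y + b) ((1 - s) • (M z + b))
    rw [← e, norm_smul, norm_smul, Real.norm_of_nonneg hs0, Real.norm_of_nonneg h1s] at h2
    have := mul_le_mul_of_nonneg_left (hNz z hz) h1s
    linarith
  have hgap : (1 - s) * K ≤ ((1 - σ) * ‖M y + b‖ + ε) / 2 := by
    rcases hsor with hs | hs
    · have : 1 - s = l := by linarith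
      rw [this, hlK]
      have := mul_nonneg hσ'.le (norm_nonneg (M y + b))
      linarith
    · have h2 : R - r ≤ ‖y - x₀‖ := by
        have h3 := norm_sub_le (y - x₀) ((1 - s) • (z - x₀))
        have e : y - x₀ - (1 - s) • (z - x₀) = s • (x - x₀) := by rw [hyx]; abel
        rw [e, hsx, hs] at h3
        linarith
      have h4 : κ * (R - r) ≤ ‖M (y - x₀)‖ :=
        (mul_le_mul_of_nonneg_left h2 hκ.le).trans (hκM _)
      have h5 : ‖M (y - x₀)‖ ≤ ‖M y + b‖ + B := by
        have h6 := norm_sub_le (M y + b) (M x₀ + b)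
        have e : M y + b - (M x₀ + b) = M (y - x₀) := by rw [map_sub]; abel
        rw [e] at h6
        linarith
      have h7 : 2 * K / (1 - σ) ≤ ‖M y + b‖ := by linarith
      rw [div_le_iff₀ hσ'] at h7
      have h9 : (1 - s) * K ≤ K := mul_le_of_le_one_left hKpos.le (by linarith)
      linarith
  have hexp : -(‖M y + b‖ - t) + ((1 - σ) * ‖M y + b‖ + ε) / 2 ≤
      -(s * (σ * ‖M x + b‖ - t - ε) + (1 - s) * L) :=
    neg_add_half_gap_le h1s hσ0.le hσ1.le hB0 (by linarith [le_abs_self t, le_abs_self L]) hconv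
      hgap
  change Real.exp (-H) * (ε / 2) ≤ ‖f m y - g y‖
  set φ := ((1 - σ) * ‖M y + b‖ + ε) / 2 with hφ
  have hφε : ε / 2 ≤ φ := by
    have := mul_nonneg hσ'.le (norm_nonneg (M y + b))
    linarith
  have hfy2 : Real.exp (-(‖M y + b‖ - t)) * Real.exp φ ≤ f m y := by
    rw [← Real.exp_add]
    exact (Real.exp_le_exp.2 hexp).trans hfy
  have hgy : g y ≤ Real.exp (-(‖M y + b‖ - t)) :=
    (hle y).trans (Real.exp_le_exp.2 (by linarith))
  have hHy : Real.exp (-H) ≤ Real.exp (-(‖M y + b‖ - t)) :=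
    Real.exp_le_exp.2 (by linarith [neg_abs_le t])
  have h8 := Real.add_one_le_exp φ
  have h9 : Real.exp (-H) * (ε / 2) ≤ Real.exp (-(‖M y + b‖ - t)) * (Real.exp φ - 1) :=
    mul_le_mul hHy (by linarith) (by positivity) (Real.exp_pos _).le
  exact le_trans (by linarith) (le_abs_self _)

/-- Dominated convergence: once `‖(p k).1 - q.1‖ < κ / 2`, the linear parts expand norms by at least
`κ / 2`, giving a common integrable majorant. -/
theorem tendsto_integral_abs_normExp_sub {n : ℕ} {p : ℕ → (Rn n →L[ℝ] Rn n) × Rn n × ℝ}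
    {q : (Rn n →L[ℝ] Rn n) × Rn n × ℝ} (hq : q.1.det ≠ 0) (hp : Tendsto p atTop (𝓝 q)) :
    Tendsto (fun k => ∫ x, |normExp (p k).1 (p k).2.1 (p k).2.2 x - normExp q.1 q.2.1 q.2.2 x|)
      atTop (𝓝 0) := by
  obtain ⟨κ, hκ, hκM⟩ := ContinuousLinearMap.exists_mul_norm_le hq
  have hκ2 : ((κ / 2) • ContinuousLinearMap.id ℝ (Rn n)).det ≠ 0 := by
    rw [ContinuousLinearMap.det_smul, ContinuousLinearMap.det, ContinuousLinearMap.coe_id,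
      LinearMap.det_id, mul_one]
    positivity
  have hint := (integrable_normExp hκ2 0 (‖q.2.1‖ + 1 + (q.2.2 + 1))).add
    (integrable_normExp hq q.2.1 q.2.2)
  have h0 : (0 : ℝ) = ∫ _ : Rn n, (0 : ℝ) := by simp
  rw [h0]
  refine tendsto_integral_filter_of_dominated_convergence _ ?_ ?_ hint ?_
  · exact Eventually.of_forall fun k => (((continuous_normExp _ _ _).sub
      (continuous_normExp _ _ _)).abs).aestronglyMeasurable
  · have e1 : ∀ᶠ k in atTop, ‖(p k).1 - q.1‖ < κ / 2 := by
      have := (tendsto_iff_norm_sub_tendsto_zero.1 ((continuous_fst.tendsto q).comp hp))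
      exact this.eventually (gt_mem_nhds (half_pos hκ))
    have e2 : ∀ᶠ k in atTop, ‖(p k).2.1‖ < ‖q.2.1‖ + 1 := by
      have hc : Continuous fun a : (Rn n →L[ℝ] Rn n) × Rn n × ℝ => ‖a.2.1‖ := by fun_prop
      exact ((hc.tendsto q).comp hp).eventually (gt_mem_nhds (lt_add_one _))
    have e3 : ∀ᶠ k in atTop, (p k).2.2 < q.2.2 + 1 := by
      have hc : Continuous fun a : (Rn n →L[ℝ] Rn n) × Rn n × ℝ => a.2.2 := by fun_prop
      exact ((hc.tendsto q).comp hp).eventually (gt_mem_nhds (lt_add_one _))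
    filter_upwards [e1, e2, e3] with k h1 h2 h3
    refine Eventually.of_forall fun x => ?_
    rw [Real.norm_eq_abs, abs_abs]
    have h4 : normExp (p k).1 (p k).2.1 (p k).2.2 x ≤
        normExp ((κ / 2) • ContinuousLinearMap.id ℝ (Rn n)) 0 (‖q.2.1‖ + 1 + (q.2.2 + 1)) x := by
      refine Real.exp_le_exp.2 ?_
      have e : ((κ / 2) • ContinuousLinearMap.id ℝ (Rn n)) x + 0 = (κ / 2) • x := by
        rw [add_zero]; rfl
      rw [e, norm_smul, Real.norm_of_nonneg (by positivity)]
      have h5 : ‖q.1 x‖ ≤ ‖(p k).1 x + (p k).2.1‖ + ‖(p k).2.1‖ + ‖((p k).1 - q.1) x‖ := by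
        have e : q.1 x = ((p k).1 x + (p k).2.1) - (p k).2.1 - ((p k).1 - q.1) x := by
          rw [_root_.sub_apply]; abel
        have h10 := norm_sub_le (((p k).1 x + (p k).2.1) - (p k).2.1) (((p k).1 - q.1) x)
        rw [← e] at h10
        exact h10.trans (add_le_add (norm_sub_le _ _) le_rfl)
      have h6 := ((p k).1 - q.1).le_of_opNorm_le h1.le x
      have h7 := hκM x
      linarith
    have h8 := normExp_pos (p k).1 (p k).2.1 (p k).2.2 x
    have h9 := normExp_pos q.1 q.2.1 q.2.2 x
    rw [Pi.add_apply, abs_le]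
    constructor <;> linarith
  · refine Eventually.of_forall fun x => ?_
    have := ((continuous_normExp_param x).tendsto q).comp hp
    simpa using (this.sub_const (normExp q.1 q.2.1 q.2.2 x)).abs

theorem exists_subseq_tendsto_integral_abs_normExp_sub {n : ℕ} {f : ℕ → Rn n → ℝ} {g : Rn n → ℝ}
    (hf : ∀ m, MemLC (f m)) (hg : MemLC g)
    (h : Tendsto (fun m => ∫ x, |f m x - g x|) atTop (𝓝 0))
    {p : ℕ → (Rn n →L[ℝ] Rn n) × Rn n × ℝ}
    (hp : ∀ m, IsMinNormExp (f m) (p m).1 (p m).2.1 (p m).2.2)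
    {M : Rn n →L[ℝ] Rn n} {b : Rn n} {t : ℝ} (hM : IsMinNormExp g M b t) :
    ∃ ms : ℕ → ℕ, Tendsto (fun k => ∫ x,
      |normExp (p (ms k)).1 (p (ms k)).2.1 (p (ms k)).2.2 x - normExp M b t x|) atTop (𝓝 0) := by
  have hmeas := tendstoInMeasure_of_tendsto_integral_abs_sub hf hg h
  obtain ⟨x₀, r, L, hr, hLg, hLf⟩ := exists_ball_eventually hf hg hmeas
  have hdet : 0 < |M.det| := abs_pos.2 hM.det_ne_zero
  have hval : ∀ η : ℝ, 0 < η → ∀ᶠ m in atTop,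
      (p m).2.2 - Real.log |(p m).1.det| ≤ t - Real.log |M.det| + η := by
    intro η hη
    -- Flattening costs `-n * log σ ≤ η / 2` and lifting costs `η / 2`; `n + 1` keeps the
    -- denominator nonzero when `n = 0`.
    set σ := Real.exp (-(η / (2 * (n + 1)))) with hσ
    have hσ0 : 0 < σ := Real.exp_pos _
    have hσ1 : σ < 1 := by
      rw [hσ, Real.exp_lt_one_iff, neg_lt_zero]
      positivity
    filter_upwards [eventually_le_normExp hf hmeas hr hLf hM.det_ne_zero hM.le hσ0 hσ1
      (half_pos hη)] with m hm
    have hσdet : (σ • M).det = σ ^ n * M.det := ContinuousLinearMap.det_smul _ _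
    have h1 := (hp m).minimal _ _ _
      (by rw [hσdet]; exact mul_ne_zero (pow_pos hσ0 n).ne' hM.det_ne_zero) hm
    rw [hσdet, abs_mul, abs_of_pos (pow_pos hσ0 n), Real.log_mul (pow_pos hσ0 n).ne' hdet.ne',
      Real.log_pow, hσ, Real.log_exp] at h1
    have h2 : n * (η / (2 * (n + 1))) ≤ η / 2 := by
      rw [mul_div_assoc', div_le_div_iff₀ (by positivity) two_pos]
      nlinarith
    linarith
  obtain ⟨R, δ, hδ, hK⟩ := exists_mem_paramSet x₀ L (t - Real.log |M.det| + 1) hr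
  have hmem : ∀ᶠ m in atTop, p m ∈ paramSet n R δ := by
    filter_upwards [hLf, hval 1 one_pos] with m h1 h2
    exact hK (f m) _ _ _ h1 (hp m).det_ne_zero (hp m).le h2
  obtain ⟨q, hq, φ, hφ, hpq⟩ := (isCompact_paramSet n R δ).tendsto_subseq' hmem.frequently
  have hmeasφ : TendstoInMeasure volume (fun k => f (φ k)) atTop g :=
    tendstoInMeasure_of_tendsto_integral_abs_sub (fun k => hf (φ k)) hg
      (h.comp hφ.tendsto_atTop)
  obtain ⟨ψ, hψ, hae⟩ := hmeasφ.exists_seq_tendsto_ae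
  have hpqψ : Tendsto (fun k => p (φ (ψ k))) atTop (𝓝 q) := hpq.comp hψ.tendsto_atTop
  have hφψ : Tendsto (fun k => φ (ψ k)) atTop atTop :=
    hφ.tendsto_atTop.comp hψ.tendsto_atTop
  have hqdet : q.1.det ≠ 0 := abs_pos.1 (hδ.trans_le hq.2)
  have hle : ∀ x, g x ≤ normExp q.1 q.2.1 q.2.2 x := by
    refine hg.logConcave.le_of_ae_le hr hLg (continuous_normExp _ _ _) (normExp_pos _ _ _) ?_
    filter_upwards [hae] with x hx
    exact le_of_tendsto_of_tendsto' hx (((continuous_normExp_param x).tendsto q).comp hpqψ)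
      fun k => (hp _).le x
  have hqval : q.2.2 - Real.log |q.1.det| ≤ t - Real.log |M.det| := by
    refine le_of_forall_pos_le_add fun η hη => ?_
    have h1 : Tendsto (fun k => (p (φ (ψ k))).2.2 - Real.log |(p (φ (ψ k))).1.det|) atTop
        (𝓝 (q.2.2 - Real.log |q.1.det|)) := by
      have hc2 : Continuous fun a : (Rn n →L[ℝ] Rn n) × Rn n × ℝ => a.2.2 := by fun_prop
      exact ((hc2.tendsto q).comp hpqψ).sub
        ((((continuous_abs_det n).tendsto q).comp hpqψ).log (abs_pos.2 hqdet).ne')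
    exact le_of_tendsto h1 (hφψ.eventually (hval η hη))
  have hqmin : IsMinNormExp g q.1 q.2.1 q.2.2 :=
    ⟨hqdet, hle, fun M' b' t' hM' h' => hqval.trans (hM.minimal M' b' t' hM' h')⟩
  refine ⟨fun k => φ (ψ k), ?_⟩
  rw [hM.normExp_eq hqmin]
  exact tendsto_integral_abs_normExp_sub hqdet hpqψ

/-- The parameters are determined only up to an isometry and need not converge; the functions do, by
the subsequence criterion. -/
theorem tendsto_integral_abs_normExp_sub_of_isMin {n : ℕ} {f : ℕ → Rn n → ℝ} {g : Rn n → ℝ}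
    (hf : ∀ m, MemLC (f m)) (hg : MemLC g)
    (h : Tendsto (fun m => ∫ x, |f m x - g x|) atTop (𝓝 0))
    {p : ℕ → (Rn n →L[ℝ] Rn n) × Rn n × ℝ}
    (hp : ∀ m, IsMinNormExp (f m) (p m).1 (p m).2.1 (p m).2.2)
    {M : Rn n →L[ℝ] Rn n} {b : Rn n} {t : ℝ} (hM : IsMinNormExp g M b t) :
    Tendsto (fun m => ∫ x, |normExp (p m).1 (p m).2.1 (p m).2.2 x - normExp M b t x|)
      atTop (𝓝 0) := by
  refine tendsto_of_subseq_tendsto fun ns hns => ?_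
  exact exists_subseq_tendsto_integral_abs_normExp_sub (fun k => hf (ns k)) hg (h.comp hns)
    (p := fun k => p (ns k)) (fun k => hp (ns k)) hM

/-! ### Löwner functions -/

/-- The linear part of an affine automorphism as a continuous linear map. -/
noncomputable def affineLinearPart {n : ℕ} (A : Rn n ≃ᵃ[ℝ] Rn n) : Rn n →L[ℝ] Rn n :=
  LinearMap.toContinuousLinearMap (A.linear : Rn n →ₗ[ℝ] Rn n)

theorem affineLinearPart_apply_add {n : ℕ} (A : Rn n ≃ᵃ[ℝ] Rn n) (x : Rn n) :
    affineLinearPart A x + A 0 = A x := by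
  have h := A.map_vadd 0 x
  rw [vadd_eq_add, add_zero] at h
  exact h.symm

theorem det_affineLinearPart_ne_zero {n : ℕ} (A : Rn n ≃ᵃ[ℝ] Rn n) :
    (affineLinearPart A).det ≠ 0 :=
  (LinearEquiv.isUnit_det' A.linear).ne_zero

theorem coneExp_eq_normExp {n : ℕ} (A : Rn n ≃ᵃ[ℝ] Rn n) (t : ℝ) :
    coneExp A t = normExp (affineLinearPart A) (A 0) t := by
  funext x
  rw [coneExp, normExp, affineLinearPart_apply_add]

theorem exists_affineEquiv_coneExp_eq {n : ℕ} {M : Rn n →L[ℝ] Rn n} (hM : M.det ≠ 0) (b : Rn n) :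
    ∃ A : Rn n ≃ᵃ[ℝ] Rn n, ∀ t, coneExp A t = normExp M b t := by
  refine ⟨(LinearMap.equivOfDetNeZero (M : Rn n →ₗ[ℝ] Rn n) hM).toAffineEquiv.trans
    (AffineEquiv.constVAdd ℝ (Rn n) b), fun t => funext fun x => ?_⟩
  have e : ((LinearMap.equivOfDetNeZero (M : Rn n →ₗ[ℝ] Rn n) hM).toAffineEquiv.trans
    (AffineEquiv.constVAdd ℝ (Rn n) b)) x = M x + b := add_comm b (M x)
  rw [coneExp, normExp, e]

theorem mem_lownerAdmissible_iff {n : ℕ} {f : Rn n → ℝ} {A : Rn n ≃ᵃ[ℝ] Rn n} {t : ℝ} :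
    (A, t) ∈ lownerAdmissible f ↔ ∀ x, f x ≤ coneExp A t x := by
  refine forall_congr' fun x => ?_
  rw [coe_le_potential_iff, coneExp, neg_sub, sub_eq_neg_add]

theorem isLownerFunction_iff {n : ℕ} {f g : Rn n → ℝ} :
    IsLownerFunction f g ↔ ∃ M b t, IsMinNormExp f M b t ∧ g = normExp M b t := by
  have hint : ∀ {M M' : Rn n →L[ℝ] Rn n} (b b' : Rn n) (t t' : ℝ), M.det ≠ 0 → M'.det ≠ 0 →
      ((∫ x, normExp M b t x ≤ ∫ x, normExp M' b' t' x) ↔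
        t - Real.log |M.det| ≤ t' - Real.log |M'.det|) := by
    intro M M' b b' t t' hM hM'
    rw [integral_normExp hM, integral_normExp hM',
      mul_le_mul_iff_of_pos_right (integral_exp_neg_norm_pos n), Real.exp_le_exp]
  constructor
  · rintro ⟨A, t, ⟨hadm, hmin⟩, rfl⟩
    have hdet := det_affineLinearPart_ne_zero A
    rw [mem_lownerAdmissible_iff] at hadm
    refine ⟨affineLinearPart A, A 0, t, ⟨hdet, ?_, fun M' b' t' hM' hle => ?_⟩,
      coneExp_eq_normExp A t⟩
    · rwa [← coneExp_eq_normExp]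
    · obtain ⟨A', hA'⟩ := exists_affineEquiv_coneExp_eq hM' b'
      rw [← hint (A 0) b' t t' hdet hM', ← coneExp_eq_normExp, ← hA']
      exact hmin A' t' (mem_lownerAdmissible_iff.2 (by rwa [hA']))
  · rintro ⟨M, b, t, h, rfl⟩
    obtain ⟨A, hA⟩ := exists_affineEquiv_coneExp_eq h.det_ne_zero b
    refine ⟨A, t, ⟨mem_lownerAdmissible_iff.2 (by rw [hA]; exact h.le), fun A' t' h' => ?_⟩,
      (hA t).symm⟩
    rw [mem_lownerAdmissible_iff, coneExp_eq_normExp] at h'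
    rw [hA, coneExp_eq_normExp, hint b (A' 0) t t' h.det_ne_zero (det_affineLinearPart_ne_zero A')]
    exact h.minimal _ _ _ (det_affineLinearPart_ne_zero A') h'

theorem IsLownerFunction.eq {n : ℕ} {f g g' : Rn n → ℝ} (h : IsLownerFunction f g)
    (h' : IsLownerFunction f g') : g = g' := by
  obtain ⟨M, b, t, hM, rfl⟩ := isLownerFunction_iff.1 h
  obtain ⟨M', b', t', hM', rfl⟩ := isLownerFunction_iff.1 h'
  exact hM.normExp_eq hM'

theorem IsLownerFunction.memLC {n : ℕ} {f g : Rn n → ℝ} (h : IsLownerFunction f g) : MemLC g := by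
  obtain ⟨M, b, t, hM, rfl⟩ := isLownerFunction_iff.1 h
  exact memLC_normExp hM.det_ne_zero b t

theorem MemLC.exists_isLownerFunction {n : ℕ} {f : Rn n → ℝ} (hf : MemLC f) :
    ∃ g, IsLownerFunction f g := by
  obtain ⟨M, b, t, h⟩ := hf.exists_isMinNormExp
  exact ⟨_, isLownerFunction_iff.2 ⟨M, b, t, h, rfl⟩⟩

theorem integral_coneExp_trans {n : ℕ} (B A : Rn n ≃ᵃ[ℝ] Rn n) (t : ℝ) :
    ∫ x, coneExp (B.trans A) t x = |(affineLinearPart B).det|⁻¹ * ∫ x, coneExp A t x := by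
  have hB := det_affineLinearPart_ne_zero B
  have h1 : ∫ x, coneExp (B.trans A) t x =
      ∫ x, coneExp A t (x + B 0) ∂(Measure.map (affineLinearPart B) volume) := by
    have hc : Continuous fun x => coneExp A t (x + B 0) := by
      rw [coneExp_eq_normExp]
      exact (continuous_normExp _ _ _).comp (continuous_add_const _)
    rw [integral_map (affineLinearPart B).measurable.aemeasurable hc.aestronglyMeasurable]
    refine integral_congr_ae (Eventually.of_forall fun x => ?_)
    change coneExp A t (B x) = coneExp A t (affineLinearPart B x + B 0)
    rw [affineLinearPart_apply_add]
  rw [h1, map_continuousLinearMap_volume hB, integral_smul_measure,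
    integral_add_right_eq_self (fun x => coneExp A t x), ENNReal.toReal_ofReal (by positivity),
    smul_eq_mul]

/-- `A ↦ B.trans A` is a bijection of the admissible pairs that scales every integral by `|det
B|⁻¹`, so it preserves minimizers. -/
theorem IsLownerFunction.comp_affineEquiv {n : ℕ} {f g : Rn n → ℝ} (h : IsLownerFunction f g)
    (B : Rn n ≃ᵃ[ℝ] Rn n) : IsLownerFunction (fun x => f (B x)) (fun x => g (B x)) := by
  obtain ⟨A, t, ⟨hadm, hmin⟩, rfl⟩ := h
  rw [mem_lownerAdmissible_iff] at hadm
  refine ⟨B.trans A, t, ⟨mem_lownerAdmissible_iff.2 fun x => hadm (B x), fun A' t' h' => ?_⟩, rfl⟩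
  rw [mem_lownerAdmissible_iff] at h'
  have e : A' = B.trans (B.symm.trans A') := by
    ext x
    simp
  rw [e, integral_coneExp_trans, integral_coneExp_trans]
  refine mul_le_mul_of_nonneg_left (hmin _ _ (mem_lownerAdmissible_iff.2 fun x => ?_))
    (by positivity)
  have := h' (B.symm x)
  rwa [B.apply_symm_apply] at this

/-- The Löwner function of every `f` in `LC(ℝⁿ)` exists, is unique and lies in `LC(ℝⁿ)`; the
resulting Löwner operator `L` is an affine covariant mapping. -/
theorem theorem5p2 (n : ℕ) :
    ∃ L : LC n → LC n,
      (∀ (f : LC n) (g : Rn n → ℝ), IsLownerFunction f.1 g ↔ g = (L f).1) ∧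
        IsAffineCovariant L := by
  choose ell hell using fun f : LC n => f.2.exists_isLownerFunction
  have hiff : ∀ (f : LC n) (g : Rn n → ℝ), IsLownerFunction f.1 g ↔ g = ell f :=
    fun f g => ⟨fun h => h.eq (hell f), fun h => h ▸ hell f⟩
  refine ⟨fun f => ⟨ell f, (hell f).memLC⟩, hiff, ⟨fun f g hfg => ?_, fun B f => ?_⟩⟩
  · obtain ⟨M, b, t, hM, hg⟩ := isLownerFunction_iff.1 (hell g)
    choose M' b' t' hM' hf using fun m => isLownerFunction_iff.1 (hell (f m))
    have := tendsto_integral_abs_normExp_sub_of_isMin (fun m => (f m).2) g.2 hfg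
      (p := fun m => (M' m, b' m, t' m)) hM' hM
    unfold LC.TendstoL1
    simpa only [hf, hg] using this
  · exact Subtype.ext ((hiff (LC.act B f) _).1 ((hell f).comp_affineEquiv B)).symm
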